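/- **Setting.** Let $\mathbb T=\mathbb R/\mathbb Z$, and let $c:\{0,1\}^{\mathbb Z}\to\mathbb R$ be a strictly positive cylinder function (it depends on finitely many coordinates). For $r\in[0,1]$ let $\nu_r$ be the Bernoulli product measure of density $r$ on $\{0,1\}^{\mathbb Z}$ and set $$B(r)=\int[1-\eta(0)]\,c(\eta)\,d\nu_r,\qquad D(r)=\int\eta(0)\,c(\eta)\,d\nu_r,\qquad F=B-D,\qquad \chi(r)=r(1-r).$$ Let $\mathcal M_+$ be the space of nonnegative measures on $\mathbb T$ of total mass at most $1$, with the weak topology, and $\mathcal M_{+,1}\subset\mathcal M_+$ the set of measures $\rho(\theta)d\theta$ with $0\le\rho\le1$ a.e. Let $D([0,T],\mathcal M_+)$ be the set of right-continuous paths with left limits. For a path $\pi\in D([0,T],\mathcal M_+)$ with $\pi_t=\rho_t(\theta)d\theta\in\mathcal M_{+,1}$ for all $t\in[0,T]$, define the energy $$\mathcal Q_T(\pi)=\sup_{G\in C^{0,1}([0,T]\times\mathbb T)}\Big\{2\int_0^T\!dt\,\langle\rho_t,\nabla G_t\rangle-\int_0^T\!dt\int_{\mathbb T}G(t,\theta)^2\,d\theta\Big\}$$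 and, for $G\in C^{1,2}([0,T]\times\mathbb T)$, $$J_{T,G}(\pi)=\langle\pi_T,G_T\rangle-\langle\pi_0,G_0\rangle-\int_0^T\!dt\,\big\langle\pi_t,\partial_tG_t+\tfrac12\Delta G_t\big\rangle-\tfrac12\int_0^T\!dt\,\langle\chi(\rho_t),(\nabla G_t)^2\rangle$$ $$\qquad-\int_0^T\!dt\,\big\{\langle B(\rho_t),e^{G_t}-1\rangle+\langle D(\rho_t),e^{-G_t}-1\rangle\big\}.$$ Set $I_T(\pi)=\sup_{G\in C^{1,2}([0,T]\times\mathbb T)}J_{T,G}(\pi)$ if $\pi_t\in\mathcal M_{+,1}$ for all $t\in[0,T]$ and $\mathcal Q_T(\pi)<\infty$, and $I_T(\pi)=\infty$ otherwise. For measurable $\gamma:\mathbb T\to[0,1]$ set $I_T(\pi|\gamma)=I_T(\pi)$ if $\pi_0=\gamma(\theta)d\theta$, and $I_T(\pi|\gamma)=\infty$ otherwise. Assume that the equation $\tfrac12\Delta\rho+F(\rho)=0$ on $\mathbb T$ has only finitely many classical solutions (that is, $C^2$ and $[0,1]$-valued) modulo translations: there are $C^2$ functions $\bar\rho_1,\dots,\bar\rho_l:\mathbb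 T\to[0,1]$ such that the set of measures $\rho(\theta)d\theta$ with $\rho$ a classical solution equals $\mathcal M_1\cup\dots\cup\mathcal M_l$, where $\mathcal M_i=\{\bar\rho_i(\theta-\omega)d\theta:\omega\in\mathbb T\}$. For $1\le i\le l$ and $\varrho\in\mathcal M_+$ let $$V_i(\varrho)=\inf\big\{I_T(\pi|\gamma):\ T>0,\ \gamma(\theta)d\theta\in\mathcal M_i,\ \pi\in D([0,T],\mathcal M_+),\ \pi_T=\varrho\big\}\in[0,\infty].$$ Let $\mathbb D$ be the set of (a.e. classes of) measurable functions $\rho$ on $\mathbb T$ with $0\le\rho\le1$ a.e., with the $L^2(\mathbb T)$-topology, and let $\mathbb V_i(\rho)=V_i(\rho(\theta)d\theta)$ for $\rho\in\mathbb D$. **Theorem 4.2.** For every $1\le i\le l$, the functional $\mathbb V_i:\mathbb D\to[0,\infty]$ is continuous at $\bar\rho_i$. Moreover, $\mathbb V_i(\rho^n)\to0$ for every sequence $(\rho^n)$ in $\mathbb D$ that converges to $\bar\rho_i$ in $L^2(\mathbb T)$. -/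

import Mathlib

open MeasureTheory ProbabilityTheory Filter Set
open scoped Topology ENNReal

namespace ReactionDiffusion

noncomputable section

/-! ## The reaction term -/

/-- Configurations on the lattice; `true` means occupied. -/
abbrev Config : Type := ℤ → Bool

/-- The occupation variable `η(0)`, as a real number. -/
def occ (η : Config) : ℝ := if η 0 then 1 else 0

/-- The Bernoulli product measure of density `r` on the configurations. -/
def bernoulliProduct (r : unitInterval) : Measure Config :=
  Measure.infinitePi (fun _ : ℤ => bernoulliMeasure true false r)

/-- `B(r) = ∫ [1 - η(0)] c(η) dν_r` for `r ∈ [0,1]`. Arguments outside `[0,1]`, which are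
irrelevant, are sent to the nearest end point. -/
def birth (c : Config → ℝ) (r : ℝ) : ℝ :=
  ∫ η, (1 - occ η) * c η ∂(bernoulliProduct (projIcc 0 1 zero_le_one r))

/-- `D(r) = ∫ η(0) c(η) dν_r` for `r ∈ [0,1]`, with the same convention outside. -/
def death (c : Config → ℝ) (r : ℝ) : ℝ :=
  ∫ η, occ η * c η ∂(bernoulliProduct (projIcc 0 1 zero_le_one r))

/-- The reaction term `F = B - D`. -/
def reaction (c : Config → ℝ) (r : ℝ) : ℝ := birth c r - death c r

/-- The mobility `χ(r) = r (1 - r)`. -/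
def mobility (r : ℝ) : ℝ := r * (1 - r)

/-! ## Measures and density profiles on the torus `ℝ / ℤ` -/

/-- The nonnegative measures on the torus with total mass at most one, with the weak topology. -/
abbrev SubMeasure : Type := {μ : FiniteMeasure UnitAddCircle // μ.mass ≤ 1}

/-- The underlying measure. -/
abbrev SubMeasure.meas (μ : SubMeasure) : Measure UnitAddCircle := (μ.1 : Measure UnitAddCircle)

/-- The density profiles: (classes of) measurable functions on the torus with values in `[0,1]`
almost everywhere, with the topology of `L²`. -/
abbrev Profile : Type :=
  {ρ : Lp ℝ 2 (volume : Measure UnitAddCircle) // ∀ᵐ θ, ρ θ ∈ Icc (0 : ℝ) 1}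

theorem withDensity_univ_le_one (f : UnitAddCircle → ℝ) (hf : ∀ᵐ θ, f θ ∈ Icc (0 : ℝ) 1) :
    (volume.withDensity (fun θ => ENNReal.ofReal (f θ))) univ ≤ 1 := by
  rw [withDensity_apply _ MeasurableSet.univ, Measure.restrict_univ]
  calc ∫⁻ θ, ENNReal.ofReal (f θ) ≤ ∫⁻ _ : UnitAddCircle, 1 := by
        refine lintegral_mono_ae ?_
        filter_upwards [hf] with θ hθ
        exact ENNReal.ofReal_le_one.2 hθ.2
    _ = 1 := by simp

/-- The measure `ρ(θ) dθ` of a density profile `ρ`, as a finite measure. -/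
def Profile.toFiniteMeasure (ρ : Profile) : FiniteMeasure UnitAddCircle :=
  ⟨volume.withDensity (fun θ => ENNReal.ofReal (ρ.1 θ)),
    ⟨(withDensity_univ_le_one _ ρ.2).trans_lt ENNReal.one_lt_top⟩⟩

theorem Profile.mass_le_one (ρ : Profile) : ρ.toFiniteMeasure.mass ≤ 1 := by
  rw [← ENNReal.coe_le_coe, FiniteMeasure.ennreal_mass]
  exact withDensity_univ_le_one _ ρ.2

/-- The measure `ρ(θ) dθ` of a density profile `ρ`. -/
def Profile.toMeasure (ρ : Profile) : SubMeasure := ⟨ρ.toFiniteMeasure, ρ.mass_le_one⟩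

/-- The set `M₊,₁` of the measures that have a density with values in `[0,1]`. -/
def boundedDensity : Set SubMeasure := range Profile.toMeasure

/-- The density of a measure with respect to the Lebesgue measure (defined almost everywhere). -/
def density (ϱ : SubMeasure) (θ : UnitAddCircle) : ℝ := (ϱ.meas.rnDeriv volume θ).toReal

/-! ## Test functions on `[0,T] × 𝕋`

Derivatives in space are those of the `1`-periodic lift to the real line; derivatives in time
are one-sided at the end points of `[0,T]`. -/

/-- A function in `C^{0,1}([0,T] × 𝕋)` with its space derivative. -/
structure Test01 (T : ℝ) where
  val : ℝ → UnitAddCircle → ℝ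
  dx : ℝ → UnitAddCircle → ℝ
  hasDeriv_dx : ∀ t ∈ Icc 0 T, ∀ x : ℝ, HasDerivAt (fun y : ℝ => val t y) (dx t x) x
  cont_val : ContinuousOn (Function.uncurry val) (Icc 0 T ×ˢ univ)
  cont_dx : ContinuousOn (Function.uncurry dx) (Icc 0 T ×ˢ univ)

/-- A function in `C^{1,2}([0,T] × 𝕋)` with its time derivative and its first and second space
derivatives. -/
structure Test12 (T : ℝ) where
  val : ℝ → UnitAddCircle → ℝ
  dt : ℝ → UnitAddCircle → ℝ
  dx : ℝ → UnitAddCircle → ℝ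
  dxx : ℝ → UnitAddCircle → ℝ
  hasDeriv_dt : ∀ t ∈ Icc 0 T, ∀ θ, HasDerivWithinAt (fun s => val s θ) (dt t θ) (Icc 0 T) t
  hasDeriv_dx : ∀ t ∈ Icc 0 T, ∀ x : ℝ, HasDerivAt (fun y : ℝ => val t y) (dx t x) x
  hasDeriv_dxx : ∀ t ∈ Icc 0 T, ∀ x : ℝ, HasDerivAt (fun y : ℝ => dx t y) (dxx t x) x
  cont_val : ContinuousOn (Function.uncurry val) (Icc 0 T ×ˢ univ)
  cont_dt : ContinuousOn (Function.uncurry dt) (Icc 0 T ×ˢ univ)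
  cont_dx : ContinuousOn (Function.uncurry dx) (Icc 0 T ×ˢ univ)
  cont_dxx : ContinuousOn (Function.uncurry dxx) (Icc 0 T ×ˢ univ)

/-! ## The dynamical rate functional

A path on `[0,T]` is represented by a map on `ℝ` whose values outside `[0,T]` play no role. -/

/-- The restriction of `π` to `[0,T]` is right-continuous with left limits. -/
def IsCadlagOn (T : ℝ) (π : ℝ → SubMeasure) : Prop :=
  (∀ t ∈ Ico 0 T, ContinuousWithinAt π (Ici t) t) ∧
    ∀ t ∈ Ioc 0 T, ∃ m, Tendsto π (𝓝[<] t) (𝓝 m)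

/-- The energy of a path with values in `M₊,₁`, with density `ρ`: the supremum over `G` of
`2 ∫₀ᵀ ⟨ρ_t, ∇G_t⟩ dt - ∫₀ᵀ ∫ G² dθ dt`. -/
def energy (T : ℝ) (π : ℝ → SubMeasure) : EReal :=
  ⨆ G : Test01 T,
    ((2 * (∫ t in (0 : ℝ)..T, ∫ θ, density (π t) θ * G.dx t θ)
      - ∫ t in (0 : ℝ)..T, ∫ θ, G.val t θ ^ 2 : ℝ) : EReal)

/-- The functional `J_{T,G}` at a path with values in `M₊,₁`. -/
def actionJ (c : Config → ℝ) (T : ℝ) (G : Test12 T) (π : ℝ → SubMeasure) : ℝ :=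
  (∫ θ, G.val T θ ∂(π T).meas) - (∫ θ, G.val 0 θ ∂(π 0).meas)
    - (∫ t in (0 : ℝ)..T, ∫ θ, (G.dt t θ + 1 / 2 * G.dxx t θ) ∂(π t).meas)
    - 1 / 2 * (∫ t in (0 : ℝ)..T, ∫ θ, mobility (density (π t) θ) * G.dx t θ ^ 2)
    - ∫ t in (0 : ℝ)..T,
        ((∫ θ, birth c (density (π t) θ) * (Real.exp (G.val t θ) - 1))
          + ∫ θ, death c (density (π t) θ) * (Real.exp (-G.val t θ) - 1))

open Classical in
/-- The rate functional `I_T` on `D([0,T], M₊)`: the supremum of `J_{T,G}` over `G` in `C^{1,2}`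
if the path takes values in `M₊,₁` and has finite energy, and `∞` otherwise. The supremum is
nonnegative, as `G = 0` shows, so that `EReal.toENNReal` does not change it. -/
def rate (c : Config → ℝ) (T : ℝ) (π : ℝ → SubMeasure) : ℝ≥0∞ :=
  if (∀ t ∈ Icc 0 T, π t ∈ boundedDensity) ∧ energy T π < ⊤ then
    (⨆ G : Test12 T, (actionJ c T G π : EReal)).toENNReal
  else ⊤

open Classical in
/-- The rate functional `I_T(π | γ)` with prescribed initial profile `γ`. -/
def rateFrom (c : Config → ℝ) (T : ℝ) (π : ℝ → SubMeasure) (γ : Profile) : ℝ≥0∞ :=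
  if π 0 = γ.toMeasure then rate c T π else ⊤

/-! ## Stationary profiles and the functionals `V_i` -/

/-- A density profile of class `C²`. -/
structure C2Profile where
  fn : UnitAddCircle → ℝ
  contDiff : ContDiff ℝ 2 (fun x : ℝ => fn x)
  mem_Icc : ∀ θ, fn θ ∈ Icc (0 : ℝ) 1

theorem C2Profile.continuous (ρ : C2Profile) : Continuous ρ.fn :=
  continuous_coinduced_dom.2 ρ.contDiff.continuous

theorem C2Profile.memLp (ρ : C2Profile) : MemLp ρ.fn 2 (volume : Measure UnitAddCircle) :=
  MemLp.of_bound ρ.continuous.aestronglyMeasurable 1 (Eventually.of_forall fun θ => by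
    rw [Real.norm_of_nonneg (ρ.mem_Icc θ).1]
    exact (ρ.mem_Icc θ).2)

/-- The class of a `C²` profile in the space of density profiles. -/
def C2Profile.toProfile (ρ : C2Profile) : Profile :=
  ⟨ρ.memLp.toLp ρ.fn, by
    filter_upwards [ρ.memLp.coeFn_toLp] with θ hθ
    rw [hθ]
    exact ρ.mem_Icc θ⟩

/-- The translate `θ ↦ ρ(θ - ω)`. -/
def C2Profile.translate (ρ : C2Profile) (ω : UnitAddCircle) : C2Profile where
  fn := fun θ => ρ.fn (θ - ω)
  contDiff := by
    obtain ⟨w, rfl⟩ := QuotientAddGroup.mk_surjective ω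
    exact ρ.contDiff.comp (contDiff_id.sub contDiff_const)
  mem_Icc := fun θ => ρ.mem_Icc (θ - ω)

/-- `ρ` is a classical solution of `(1/2) Δρ + F(ρ) = 0` on the torus. -/
def IsStationary (c : Config → ℝ) (ρ : C2Profile) : Prop :=
  ∀ x : ℝ, 1 / 2 * iteratedDeriv 2 (fun y : ℝ => ρ.fn y) x + reaction c (ρ.fn x) = 0

/-- The set of the measures whose density is a classical stationary solution. -/
def solMeasures (c : Config → ℝ) : Set SubMeasure :=
  {ϱ | ∃ ρ : C2Profile, IsStationary c ρ ∧ ϱ = ρ.toProfile.toMeasure}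

/-- The set of the measures whose density is a translate of `ρ`. -/
def orbitMeasures (ρ : C2Profile) : Set SubMeasure :=
  {ϱ | ∃ ω : UnitAddCircle, ϱ = (ρ.translate ω).toProfile.toMeasure}

/-- The minimal cost `V(ϱ)` to create the measure `ϱ` from the translates of `ρbar`: the infimum
of `I_T(π | γ)` over all `T > 0`, all `γ` such that `γ(θ) dθ` has a translate of `ρbar` as
density, and all `π ∈ D([0,T], M₊)` with `π_T = ϱ`. -/
def quasiPotential (c : Config → ℝ) (ρbar : C2Profile) (ϱ : SubMeasure) : ℝ≥0∞ :=
  ⨅ (T : ℝ) (_ : 0 < T) (γ : Profile) (_ : γ.toMeasure ∈ orbitMeasures ρbar)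
    (π : ℝ → SubMeasure) (_ : IsCadlagOn T π) (_ : π T = ϱ), rateFrom c T π γ

/-- The functional `V` on the density profiles. -/
def profilePotential (c : Config → ℝ) (ρbar : C2Profile) (ρ : Profile) : ℝ≥0∞ :=
  quasiPotential c ρbar ρ.toMeasure

end

end ReactionDiffusion

open ReactionDiffusion

/-! A density `f` close in L¹ to a stationary profile `p` is joined to it by a path of arbitrarily
small cost. A stationary profile takes values in the open interval `(0,1)`: at a zero the equation
would force a negative second derivative at a minimum, because `F(0) > 0`, and the value `1` is
excluded in the same way (`IsStationary.mem_Ioo`). By compactness `p` stays at a positive distance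
from `0` and `1`.

The target `f` is merely measurable, so it is reached through its heat regularisation `q = heat δ
f`. The path first moves linearly from `p` to `q` during a time `τ`, then follows the heat flow of
`f` backwards from `q` to `f` during a time `δ`.

On the linear piece, if the speed does not exceed the birth and death rates along the path, the term
linear in `G` is absorbed by `B e^G + D e^{-G}`. The gradient term is bounded by completing a
square, and the cost is `O(τ)` (`localAction_le_of_slow`). This needs `q - p` uniformly small
compared with `τ`, and `∇q` bounded. Both follow from the smoothing of the heat kernel once `δ` is
fixed and `f - p` is small in L¹.

On the backward piece `∂ₜw = -½Δw`, so that after integration by parts the cost is at most `∫∫ (∇w)²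
/ (2χ(w)) + O(δ)`. The double integral is exactly the decrease of the entropy `∫ binEntropy(w)`
(`integral_dissipation_eq`). Entropy is L¹-continuous on `[0,1]`-valued functions, and both ends of
the piece are L¹-close to `p`; hence this cost is small as well (`exists_abs_entropy_sub_le`).

`rate_cheapPath_le` adds the two costs, `exists_cheap_path` chooses the constants, and
`tendsto_profilePotential` passes to the quasi-potential, using that the L² distance dominates the
L¹ distance on the torus. -/

namespace ReactionDiffusion

noncomputable section

/-! ### Birth and death rates -/

/-- A cylinder function only sees a finite product of two-point measures, so its mean is a
polynomial in the density. Continuity of `birth` and `death` rests on this. -/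
theorem integral_bernoulliProduct_of_restrict (Λ : Finset ℤ) (g : (Λ → Bool) → ℝ)
    (p : unitInterval) :
    ∫ η, g (Λ.restrict η) ∂(bernoulliProduct p)
      = ∑ x : Λ → Bool, (∏ i, if x i then (p : ℝ) else 1 - p) * g x := by
  have hg : AEStronglyMeasurable g (Measure.pi fun _ : Λ => bernoulliMeasure true false p) :=
    (measurable_of_finite g).aestronglyMeasurable
  refine (integral_restrict_infinitePi (μ := fun _ : ℤ => bernoulliMeasure true false p) hg).trans ?_
  rw [integral_fintype .of_finite]
  refine Finset.sum_congr rfl fun x _ => ?_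
  rw [smul_eq_mul, Measure.real, Measure.pi_singleton, ENNReal.toReal_prod]
  congr 1
  refine Finset.prod_congr rfl fun i _ => ?_
  change (bernoulliMeasure true false p).real {x i} = _
  rw [bernoulliMeasure_real_apply _ (measurableSet_singleton _)]
  cases x i <;> simp

theorem measurable_of_dependsOn {Λ : Finset ℤ} {φ : Config → ℝ} (h : DependsOn φ (Λ : Set ℤ)) :
    Measurable φ := by
  obtain ⟨g, rfl⟩ := dependsOn_iff_exists_comp.1 h
  exact (measurable_of_finite g).comp (measurable_pi_lambda _ fun i => measurable_pi_apply _)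

/-- A cylinder function has finite range, so positivity upgrades to a uniform lower bound. -/
theorem exists_bounds_of_dependsOn {Λ : Finset ℤ} {φ : Config → ℝ}
    (h : DependsOn φ (Λ : Set ℤ)) (hpos : ∀ η, 0 < φ η) :
    ∃ m M : ℝ, 0 < m ∧ ∀ η, m ≤ φ η ∧ φ η ≤ M := by
  have hfin : (range φ).Finite := by
    obtain ⟨g, rfl⟩ := dependsOn_iff_exists_comp.1 h
    exact (finite_range g).subset (range_comp_subset_range _ _)
  have hne : (range φ).Nonempty := range_nonempty φ
  obtain ⟨_, ⟨a, rfl⟩, ha⟩ := exists_min_image (range φ) id hfin hne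
  obtain ⟨M, hM⟩ := hfin.bddAbove
  exact ⟨φ a, M, hpos a, fun η => ⟨ha (φ η) ⟨η, rfl⟩, hM ⟨η, rfl⟩⟩⟩

theorem continuous_integral_bernoulliProduct {Λ : Finset ℤ} {φ : Config → ℝ}
    (h : DependsOn φ (Λ : Set ℤ)) :
    Continuous fun r : ℝ => ∫ η, φ η ∂(bernoulliProduct (projIcc 0 1 zero_le_one r)) := by
  obtain ⟨g, rfl⟩ := dependsOn_iff_exists_comp.1 h
  have : ∀ p : unitInterval, ∫ η, (g ∘ (Λ : Set ℤ).domRestrict) η ∂(bernoulliProduct p)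
      = ∑ x : Λ → Bool, (∏ i, if x i then (p : ℝ) else 1 - p) * g x :=
    integral_bernoulliProduct_of_restrict Λ g
  simp_rw [this]
  refine continuous_finsetSum _ fun x _ => ?_
  refine (continuous_finsetProd _ fun i _ => ?_).mul continuous_const
  have : Continuous fun r : ℝ => ((projIcc 0 1 zero_le_one r : unitInterval) : ℝ) :=
    continuous_subtype_val.comp continuous_projIcc
  cases x i
  · simpa using (continuous_const (y := (1 : ℝ))).fun_sub this
  · simpa using this

instance (p : unitInterval) : IsProbabilityMeasure (bernoulliProduct p) := by
  unfold bernoulliProduct; infer_instance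

theorem measurable_occ : Measurable occ :=
  Measurable.ite (measurableSet_eq_fun (measurable_pi_apply 0) measurable_const)
    measurable_const measurable_const

theorem occ_mem_Icc (η : Config) : occ η ∈ Icc (0 : ℝ) 1 := by
  unfold occ; split_ifs <;> simp

theorem integral_occ (p : unitInterval) : ∫ η, occ η ∂(bernoulliProduct p) = p := by
  have := (measurePreserving_eval_infinitePi (fun _ : ℤ => bernoulliMeasure true false p) 0)
  have : ∫ η, occ η ∂(bernoulliProduct p)
      = ∫ b, (if b = true then (1 : ℝ) else 0) ∂(bernoulliMeasure true false p) := by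
    rw [← this.map_eq, integral_map (measurable_pi_apply _).aemeasurable
      (measurable_of_finite _).aestronglyMeasurable]
    rfl
  rw [this, integral_bernoulliMeasure]
  simp

/-- The properties of the birth and death rates that the construction of cheap paths uses. -/
structure RateBounds (B D : ℝ → ℝ) (m M : ℝ) : Prop where
  m_pos : 0 < m
  M_nonneg : 0 ≤ M
  cont_B : Continuous B
  cont_D : Continuous D
  le_B : ∀ r ∈ Icc (0 : ℝ) 1, m * (1 - r) ≤ B r
  B_le : ∀ r ∈ Icc (0 : ℝ) 1, B r ≤ M * (1 - r)
  le_D : ∀ r ∈ Icc (0 : ℝ) 1, m * r ≤ D r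
  D_le : ∀ r ∈ Icc (0 : ℝ) 1, D r ≤ M * r

/-- Integrate `m ≤ c ≤ M` against `1 - η(0)` and `η(0)`, whose means under `ν_r` are `1 - r` and
`r`. -/
theorem exists_rateBounds (c : Config → ℝ) (hpos : ∀ η, 0 < c η)
    (hcyl : ∃ Λ : Finset ℤ, DependsOn c (Λ : Set ℤ)) :
    ∃ m M, RateBounds (birth c) (death c) m M := by
  obtain ⟨Λ, hΛ⟩ := hcyl
  obtain ⟨m, M, hm, hb⟩ := exists_bounds_of_dependsOn hΛ hpos
  have hM : 0 ≤ M := hm.le.trans ((hb fun _ => true).1.trans (hb fun _ => true).2)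
  have hocc : DependsOn occ ((insert 0 Λ : Finset ℤ) : Set ℤ) := fun x y h => by
    unfold occ; rw [h 0 (by simp)]
  have hc : DependsOn c ((insert 0 Λ : Finset ℤ) : Set ℤ) := fun x y h =>
    hΛ fun i hi => h i (by simp only [Finset.coe_insert, mem_insert_iff]; exact Or.inr hi)
  have hB : DependsOn (fun η => (1 - occ η) * c η) ((insert 0 Λ : Finset ℤ) : Set ℤ) :=
    fun x y h => by simp only [hocc h, hc h]
  have hD : DependsOn (fun η => occ η * c η) ((insert 0 Λ : Finset ℤ) : Set ℤ) :=
    fun x y h => by simp only [hocc h, hc h]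
  have hint : ∀ (p : unitInterval) (φ : Config → ℝ), Measurable φ → (∀ η, φ η ∈ Icc (0 : ℝ) 1) →
      Integrable φ (bernoulliProduct p) := fun p φ hφ h01 =>
    Integrable.of_bound hφ.aestronglyMeasurable 1 (Eventually.of_forall fun η => by
      rw [Real.norm_of_nonneg (h01 η).1]; exact (h01 η).2)
  have hmulint : ∀ (p : unitInterval) (φ : Config → ℝ), Measurable φ →
      (∀ η, φ η ∈ Icc (0 : ℝ) 1) → Integrable (fun η => φ η * c η) (bernoulliProduct p) :=
    fun p φ hφ h01 => by
      refine Integrable.of_bound (hφ.mul (measurable_of_dependsOn hΛ)).aestronglyMeasurable M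
        (Eventually.of_forall fun η => ?_)
      rw [Real.norm_of_nonneg (mul_nonneg (h01 η).1 (hpos η).le)]
      nlinarith [h01 η, hb η, (h01 η).1, (h01 η).2, (hb η).1, (hb η).2]
  have key : ∀ (p : unitInterval) (φ : Config → ℝ), Measurable φ → (∀ η, φ η ∈ Icc (0 : ℝ) 1) →
      m * ∫ η, φ η ∂(bernoulliProduct p) ≤ ∫ η, φ η * c η ∂(bernoulliProduct p) ∧
      ∫ η, φ η * c η ∂(bernoulliProduct p) ≤ M * ∫ η, φ η ∂(bernoulliProduct p) :=
    fun p φ hφ h01 => by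
      rw [← integral_const_mul, ← integral_const_mul]
      constructor
      · refine integral_mono ((hint p φ hφ h01).const_mul _) (hmulint p φ hφ h01) fun η => ?_
        simpa [mul_comm] using mul_le_mul_of_nonneg_left (hb η).1 (h01 η).1
      · refine integral_mono (hmulint p φ hφ h01) ((hint p φ hφ h01).const_mul _) fun η => ?_
        simpa [mul_comm] using mul_le_mul_of_nonneg_left (hb η).2 (h01 η).1
  have h1 : Measurable fun η => 1 - occ η := measurable_const.sub measurable_occ
  have h1' : ∀ η, 1 - occ η ∈ Icc (0 : ℝ) 1 := fun η => by
    have := occ_mem_Icc η; constructor <;> linarith [this.1, this.2]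
  have h2 : ∀ p : unitInterval, ∫ η, (1 - occ η) ∂(bernoulliProduct p) = 1 - p := fun p => by
    rw [integral_sub (integrable_const _) (hint p _ measurable_occ occ_mem_Icc), integral_occ]
    simp
  have hp : ∀ r ∈ Icc (0 : ℝ) 1, ((projIcc 0 1 zero_le_one r : unitInterval) : ℝ) = r :=
    fun r hr => by rw [projIcc_of_mem _ hr]
  refine ⟨m, M, hm, hM, continuous_integral_bernoulliProduct hB,
    continuous_integral_bernoulliProduct hD, ?_, ?_, ?_, ?_⟩ <;> intro r hr
  · simpa [h2, hp r hr, birth] using (key (projIcc 0 1 zero_le_one r) _ h1 h1').1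
  · simpa [h2, hp r hr, birth] using (key (projIcc 0 1 zero_le_one r) _ h1 h1').2
  · simpa [integral_occ, hp r hr, death] using
      (key (projIcc 0 1 zero_le_one r) _ measurable_occ occ_mem_Icc).1
  · simpa [integral_occ, hp r hr, death] using
      (key (projIcc 0 1 zero_le_one r) _ measurable_occ occ_mem_Icc).2

/-! ### Calculus on the torus -/

theorem continuousOn_integral_torus {S : Set ℝ} [LocallyCompactSpace S]
    {φ : ℝ → UnitAddCircle → ℝ} (h : ContinuousOn (Function.uncurry φ) (S ×ˢ univ)) :
    ContinuousOn (fun t => ∫ θ, φ t θ) S := by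
  rw [continuousOn_iff_continuous_domRestrict]
  have h' : Continuous (Function.uncurry fun (t : S) θ => φ t θ) :=
    h.comp_continuous (f := fun p : S × UnitAddCircle => ((p.1 : ℝ), p.2)) (by fun_prop)
      fun p => ⟨p.1.2, mem_univ _⟩
  have := continuous_parametric_integral_of_continuous (μ := volume) h' isCompact_univ
  simp only [Measure.restrict_univ] at this
  exact this

/-- The paths below are jointly continuous on `[0,T)` only, their final profile being merely
measurable, so parametric integrals are needed over half-open time intervals. -/
instance locallyCompactSpace_Ico (a b : ℝ) : LocallyCompactSpace (Ico a b) := by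
  rw [← Ici_inter_Iio]
  exact (isClosed_Ici.isLocallyClosed.inter isOpen_Iio.isLocallyClosed).locallyCompactSpace

theorem continuousOn_slice {S : Set ℝ} {φ : ℝ → UnitAddCircle → ℝ}
    (h : ContinuousOn (Function.uncurry φ) (S ×ˢ univ)) {t : ℝ} (ht : t ∈ S) :
    Continuous (φ t) :=
  h.comp_continuous (f := fun θ => (t, θ)) (by fun_prop) fun _ => ⟨ht, mem_univ _⟩

theorem continuousOn_section {S : Set ℝ} {φ : ℝ → UnitAddCircle → ℝ}
    (h : ContinuousOn (Function.uncurry φ) (S ×ˢ univ)) (θ : UnitAddCircle) :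
    ContinuousOn (fun t => φ t θ) S :=
  h.comp (f := fun t => (t, θ)) (by fun_prop) fun _ ht => ⟨ht, mem_univ _⟩

theorem integrable_of_continuous {g : UnitAddCircle → ℝ} (hg : Continuous g) : Integrable g := by
  rw [← integrableOn_univ]
  exact hg.continuousOn.integrableOn_compact isCompact_univ

theorem integral_deriv_eq_zero {g g' : UnitAddCircle → ℝ}
    (h : ∀ x : ℝ, HasDerivAt (fun y : ℝ => g y) (g' x) x) (hg' : Continuous g') :
    ∫ θ, g' θ = 0 := by
  rw [← UnitAddCircle.intervalIntegral_preimage 0,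
    intervalIntegral.integral_eq_sub_of_hasDerivAt (fun x _ => h x)
      ((hg'.comp (AddCircle.continuous_mk' 1)).intervalIntegrable _ _)]
  simp [show ((1 : ℝ) : UnitAddCircle) = 0 from AddCircle.coe_period (1 : ℝ)]

theorem continuous_of_lift {g : UnitAddCircle → ℝ} (h : Continuous fun x : ℝ => g x) :
    Continuous g := continuous_coinduced_dom.2 h

theorem continuous_of_hasDerivAt {g g' : UnitAddCircle → ℝ}
    (h : ∀ x : ℝ, HasDerivAt (fun y : ℝ => g y) (g' x) x) : Continuous g :=
  continuous_of_lift (continuous_iff_continuousAt.2 fun x => (h x).continuousAt)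

/-- Integration by parts on the torus. -/
theorem integral_mul_deriv_torus {g g' k k' : UnitAddCircle → ℝ}
    (hg : ∀ x : ℝ, HasDerivAt (fun y : ℝ => g y) (g' x) x) (hg' : Continuous g')
    (hk : ∀ x : ℝ, HasDerivAt (fun y : ℝ => k y) (k' x) x) (hk' : Continuous k') :
    ∫ θ, g θ * k' θ = -∫ θ, g' θ * k θ := by
  have hgc := continuous_of_hasDerivAt hg
  have hkc := continuous_of_hasDerivAt hk
  have := integral_deriv_eq_zero (g := fun θ => g θ * k θ)
    (g' := fun θ => g' θ * k θ + g θ * k' θ) (fun x => (hg x).mul (hk x)) (by fun_prop)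
  rw [integral_add (integrable_of_continuous (by fun_prop))
    (integrable_of_continuous (by fun_prop))] at this
  linarith

/-- The fundamental theorem of calculus in time, integrated over the torus. -/
theorem integral_sub_eq_integral_deriv {a b : ℝ} (hab : a ≤ b) {φ φt : ℝ → UnitAddCircle → ℝ}
    (h : ∀ t ∈ Icc a b, ∀ θ, HasDerivWithinAt (fun s => φ s θ) (φt t θ) (Icc a b) t)
    (hφ : ContinuousOn (Function.uncurry φ) (Icc a b ×ˢ univ))
    (hφt : ContinuousOn (Function.uncurry φt) (Icc a b ×ˢ univ)) :
    (∫ θ, φ b θ) - ∫ θ, φ a θ = ∫ t in a..b, ∫ θ, φt t θ := by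
  have hint : Integrable (Function.uncurry φt)
      ((volume.restrict (Ioc a b)).prod (volume : Measure UnitAddCircle)) := by
    have h1 : IntegrableOn (Function.uncurry φt) (Icc a b ×ˢ univ)
        ((volume : Measure ℝ).prod (volume : Measure UnitAddCircle)) :=
      hφt.integrableOn_compact (isCompact_Icc.prod isCompact_univ)
    have h2 := h1.mono_set (prod_mono_left (t := univ) (Ioc_subset_Icc_self (a := a) (b := b)))
    rwa [IntegrableOn, ← Measure.prod_restrict, Measure.restrict_univ] at h2
  rw [intervalIntegral.integral_of_le hab, integral_integral_swap hint, ← integral_sub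
    (integrable_of_continuous (continuousOn_slice hφ (right_mem_Icc.2 hab)))
    (integrable_of_continuous (continuousOn_slice hφ (left_mem_Icc.2 hab)))]
  refine integral_congr_ae (Eventually.of_forall fun θ => ?_)
  have hc := continuousOn_section hφt θ
  simp only
  rw [← intervalIntegral.integral_of_le hab]
  refine (intervalIntegral.integral_eq_sub_of_hasDerivAt_of_le hab (continuousOn_section hφ θ)
    (fun t ht => (h t (Ioo_subset_Icc_self ht) θ).hasDerivAt (Icc_mem_nhds ht.1 ht.2))
    (hc.intervalIntegrable_of_Icc hab)).symm

/-- Uniform continuity handles close points; for points at distance at least `δ` the trivial bound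
`2M` is absorbed by the quadratic term. The square is convenient because its Gaussian mean is the
variance. -/
theorem exists_modulus {α : Type*} [PseudoMetricSpace α] [CompactSpace α] {g : α → ℝ}
    (hg : Continuous g) {η : ℝ} (hη : 0 < η) :
    ∃ C, 0 ≤ C ∧ ∀ x y, |g x - g y| ≤ η + C * dist x y ^ 2 := by
  obtain ⟨δ, hδ, h⟩ := Metric.uniformContinuous_iff.1
    (CompactSpace.uniformContinuous_of_continuous hg) η hη
  obtain ⟨M, hM⟩ := (isCompact_range hg.norm).bddAbove
  have hM' : ∀ x, |g x| ≤ M := fun x => hM ⟨x, rfl⟩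
  rcases isEmpty_or_nonempty α with hα | ⟨⟨x₀⟩⟩
  · exact ⟨0, le_rfl, fun x => (IsEmpty.false x).elim⟩
  have hM0 : 0 ≤ M := (abs_nonneg _).trans (hM' x₀)
  refine ⟨2 * M / δ ^ 2, by positivity, fun x y => ?_⟩
  rcases lt_or_ge (dist x y) δ with hd | hd
  · have := h hd
    rw [Real.dist_eq] at this
    have : 0 ≤ 2 * M / δ ^ 2 * dist x y ^ 2 := by positivity
    linarith
  · have h1 : |g x - g y| ≤ 2 * M := by
      have := abs_sub (g x) (g y)
      linarith [hM' x, hM' y]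
    have h2 : 2 * M ≤ 2 * M / δ ^ 2 * dist x y ^ 2 := by
      rw [div_mul_eq_mul_div, le_div_iff₀ (by positivity)]
      exact mul_le_mul_of_nonneg_left (pow_le_pow_left₀ hδ.le hd 2) (by positivity)
    linarith

theorem intervalIntegrable_of_continuousOn_Ico {a b C : ℝ} (hab : a ≤ b) {g : ℝ → ℝ}
    (hg : ContinuousOn g (Ico a b)) (hb : ∀ t ∈ Ico a b, |g t| ≤ C) :
    IntervalIntegrable g volume a b := by
  rw [intervalIntegrable_iff_integrableOn_Ico_of_le hab]
  exact IntegrableOn.of_bound (by simp) (hg.aestronglyMeasurable measurableSet_Ico) C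
    ((ae_restrict_iff' measurableSet_Ico).2 (Eventually.of_forall hb))

/-! ### The heat semigroup on the torus -/

/-- The heat semigroup with generator `(1/2) Δ` on the torus. -/
def heat (s : ℝ) (f : UnitAddCircle → ℝ) (θ : UnitAddCircle) : ℝ :=
  ∫ z : ℝ, f (θ + (z : UnitAddCircle)) ∂(gaussianReal 0 s.toNNReal)

/-- The kernel `w ^ k * exp (-w² / (2 s))`. -/
def heatKernel (k : ℕ) (s w : ℝ) : ℝ := w ^ k * Real.exp (-w ^ 2 / (2 * s))

/-- The convolution of `f` with the kernel `w ^ k * exp (-w² / (2 s))`. -/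
def heatMoment (k : ℕ) (s : ℝ) (f : UnitAddCircle → ℝ) (θ : UnitAddCircle) : ℝ :=
  ∫ z : ℝ, f (θ + (z : UnitAddCircle)) * heatKernel k s z

/-- An integrable function that dominates the kernels for parameters close to `(s₀, x₀)`. -/
def heatMajorant (s₀ x₀ y : ℝ) : ℝ :=
  (1 + 8 * s₀) * Real.exp (1 / (8 * s₀)) * Real.exp (-(1 / (16 * s₀)) * (y - x₀) ^ 2)

theorem integrable_heatMajorant {s₀ : ℝ} (hs : 0 < s₀) (x₀ : ℝ) :
    Integrable (heatMajorant s₀ x₀) :=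
  ((integrable_exp_neg_mul_sq (b := 1 / (16 * s₀)) (by positivity)).comp_sub_right x₀).const_mul _

/-- The exponent is at most `-w²/(4s₀)`. Half of it absorbs the polynomial factor, through `1 + w² ≤
(1 + 8s₀) exp(w²/(8s₀))`; the other half is recentred at `x₀` by `(y - x₀)² ≤ 2w² + 2`. -/
theorem abs_heatKernel_le {k : ℕ} (hk : k ≤ 2) {s₀ s x₀ x y : ℝ} (hs₀ : 0 < s₀) (hs : 0 < s)
    (hs2 : s ≤ 2 * s₀) (hx : |x - x₀| ≤ 1) :
    |heatKernel k s (y - x)| ≤ heatMajorant s₀ x₀ y := by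
  set w := y - x with hw
  have hpow : |w ^ k| ≤ 1 + w ^ 2 := by
    rw [abs_pow, ← sq_abs w]
    have := abs_nonneg w
    interval_cases k <;> nlinarith [sq_nonneg (|w| - 1)]
  have h1 : 1 + w ^ 2 ≤ (1 + 8 * s₀) * Real.exp (w ^ 2 / (8 * s₀)) := by
    have h := Real.add_one_le_exp (w ^ 2 / (8 * s₀))
    have h0 : 0 ≤ w ^ 2 / (8 * s₀) := by positivity
    have h2 : 8 * s₀ * (w ^ 2 / (8 * s₀)) = w ^ 2 := by field_simp
    nlinarith
  have h2 : Real.exp (-w ^ 2 / (2 * s)) ≤ Real.exp (-w ^ 2 / (4 * s₀)) := by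
    rw [Real.exp_le_exp, neg_div, neg_div, neg_le_neg_iff]
    exact div_le_div_of_nonneg_left (sq_nonneg w) (by positivity) (by linarith)
  have h3 : (y - x₀) ^ 2 ≤ 2 * w ^ 2 + 2 := by
    have : (x - x₀) ^ 2 ≤ 1 := by rw [← sq_abs]; nlinarith [abs_nonneg (x - x₀)]
    nlinarith [sq_nonneg (w - (x - x₀))]
  rw [heatKernel, abs_mul, Real.abs_exp, heatMajorant]
  calc |w ^ k| * Real.exp (-w ^ 2 / (2 * s))
      ≤ ((1 + 8 * s₀) * Real.exp (w ^ 2 / (8 * s₀))) * Real.exp (-w ^ 2 / (4 * s₀)) := by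
        gcongr; exact hpow.trans h1
    _ = (1 + 8 * s₀) * Real.exp (-w ^ 2 / (8 * s₀)) := by
        rw [mul_assoc, ← Real.exp_add]; congr 2; field_simp; ring
    _ ≤ (1 + 8 * s₀) * Real.exp (1 / (8 * s₀) + -(1 / (16 * s₀)) * (y - x₀) ^ 2) := by
        gcongr
        have : 1 / (8 * s₀) + -(1 / (16 * s₀)) * (y - x₀) ^ 2 - -w ^ 2 / (8 * s₀)
            = (2 * w ^ 2 + 2 - (y - x₀) ^ 2) / (16 * s₀) := by field_simp; ring
        have h4 : 0 ≤ (2 * w ^ 2 + 2 - (y - x₀) ^ 2) / (16 * s₀) :=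
          div_nonneg (by linarith) (by positivity)
        linarith
    _ = _ := by rw [Real.exp_add, mul_assoc]

theorem continuous_heatKernel (k : ℕ) (s : ℝ) : Continuous (heatKernel k s) := by
  unfold heatKernel; fun_prop

/-- Moves the dependence on `x` from `f`, which has no regularity, to the smooth kernel. -/
theorem heatMoment_coe (k : ℕ) (s : ℝ) (f : UnitAddCircle → ℝ) (x : ℝ) :
    heatMoment k s f x = ∫ y : ℝ, f y * heatKernel k s (y - x) := by
  rw [← integral_add_left_eq_self (fun y : ℝ => f y * heatKernel k s (y - x)) x]
  simp [heatMoment]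

/-! ### Regularity of the Gaussian moments of a bounded measurable function -/

section regularity

variable {f : UnitAddCircle → ℝ}

theorem measurable_lift (hf : Measurable f) : Measurable fun y : ℝ => f y :=
  hf.comp (AddCircle.continuous_mk' 1).measurable

theorem norm_mul_heatKernel_le (hb : ∀ θ, |f θ| ≤ 1) {k : ℕ} (hk : k ≤ 2) {s₀ s x₀ x y : ℝ}
    (hs₀ : 0 < s₀) (hs : 0 < s) (hs2 : s ≤ 2 * s₀) (hx : |x - x₀| ≤ 1) :
    ‖f y * heatKernel k s (y - x)‖ ≤ heatMajorant s₀ x₀ y := by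
  rw [Real.norm_eq_abs, abs_mul]
  calc |f y| * |heatKernel k s (y - x)| ≤ 1 * |heatKernel k s (y - x)| := by
        gcongr; exact hb _
    _ ≤ _ := by rw [one_mul]; exact abs_heatKernel_le hk hs₀ hs hs2 hx

theorem aestronglyMeasurable_mul_heatKernel (hf : Measurable f) (k : ℕ) (s x : ℝ) :
    AEStronglyMeasurable (fun y : ℝ => f y * heatKernel k s (y - x)) :=
  ((measurable_lift hf).mul ((continuous_heatKernel k s).comp
    (continuous_id.sub continuous_const)).measurable).aestronglyMeasurable

theorem integrable_mul_heatKernel (hf : Measurable f) (hb : ∀ θ, |f θ| ≤ 1) {k : ℕ} (hk : k ≤ 2)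
    {s : ℝ} (hs : 0 < s) (x : ℝ) : Integrable fun y : ℝ => f y * heatKernel k s (y - x) :=
  (integrable_heatMajorant hs x).mono' (aestronglyMeasurable_mul_heatKernel hf k s x)
    (Eventually.of_forall fun y => norm_mul_heatKernel_le hb hk hs hs (by linarith) (by simp))

/-- Joint continuity in time and space can thus be tested on the lift to `ℝ × ℝ`. -/
theorem isOpenQuotientMap_prod_coe :
    IsOpenQuotientMap (Prod.map id (fun x : ℝ => (x : UnitAddCircle)) : ℝ × ℝ → _) :=
  IsOpenQuotientMap.id.prodMap QuotientAddGroup.isOpenQuotientMap_mk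

theorem continuousOn_heatMoment (hf : Measurable f) (hb : ∀ θ, |f θ| ≤ 1) {k : ℕ} (hk : k ≤ 2) :
    ContinuousOn (fun p : ℝ × UnitAddCircle => heatMoment k p.1 f p.2) (Ioi 0 ×ˢ univ) := by
  refine continuousOn_of_forall_continuousAt fun ⟨s₀, θ⟩ hp => ?_
  obtain ⟨x₀, rfl⟩ := QuotientAddGroup.mk_surjective θ
  have hs₀ : 0 < s₀ := hp.1
  have : ((s₀, QuotientAddGroup.mk x₀) : ℝ × UnitAddCircle)
    = Prod.map id (fun x : ℝ => (x : UnitAddCircle)) (s₀, x₀) := rfl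
  rw [this, ← isOpenQuotientMap_prod_coe.continuousAt_comp_iff]
  have heq : (fun p : ℝ × UnitAddCircle => heatMoment k p.1 f p.2)
      ∘ Prod.map id (fun x : ℝ => (x : UnitAddCircle))
      = fun p : ℝ × ℝ => ∫ y : ℝ, f y * heatKernel k p.1 (y - p.2) :=
    funext fun p => heatMoment_coe k p.1 f p.2
  rw [heq]
  refine continuousAt_of_dominated (bound := heatMajorant s₀ x₀)
    (Eventually.of_forall fun p => aestronglyMeasurable_mul_heatKernel hf k p.1 p.2) ?_
    (integrable_heatMajorant hs₀ x₀) (Eventually.of_forall fun y => ?_)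
  · have h1 : ∀ᶠ p : ℝ × ℝ in 𝓝 (s₀, x₀), p.1 ∈ Ioo 0 (2 * s₀) :=
      continuous_fst.continuousAt.eventually (Ioo_mem_nhds hs₀ (by simp; linarith))
    have h2 : ∀ᶠ p : ℝ × ℝ in 𝓝 (s₀, x₀), p.2 ∈ Metric.closedBall x₀ 1 :=
      continuous_snd.continuousAt.eventually (Metric.closedBall_mem_nhds x₀ one_pos)
    filter_upwards [h1, h2] with p hp1 hp2
    exact Eventually.of_forall fun y => norm_mul_heatKernel_le hb hk hs₀ hp1.1 hp1.2.le hp2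
  · unfold heatKernel
    refine continuousAt_const.mul (ContinuousAt.mul (by fun_prop)
      (Real.continuous_exp.continuousAt.comp (ContinuousAt.div (by fun_prop) (by fun_prop) ?_)))
    simp; exact hs₀.ne'

/-- Differentiation under the integral, done once for both orders. The disjunction in `hab` covers
the two kernels that arise, and bounds `K` by `|a| + |b|` times the majorant. The sign in `hd`
compensates the one from differentiating `y - x` in `x`. -/
theorem hasDerivAt_heatMoment_of_kernel (hf : Measurable f) (hb : ∀ θ, |f θ| ≤ 1) {k : ℕ}
    (hk : k ≤ 2) {s : ℝ} (hs : 0 < s) {K : ℝ → ℝ} (hK : Continuous K) {a b : ℝ}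
    (hab : ∀ w, K w = a * heatKernel 0 s w + b * heatKernel 2 s w ∨
      K w = a * heatKernel 1 s w + b * heatKernel 2 s w)
    (hd : ∀ w, HasDerivAt (heatKernel k s) (-K w) w) (x : ℝ) :
    HasDerivAt (fun x : ℝ => heatMoment k s f x) (∫ y : ℝ, f y * K (y - x)) x := by
  simp_rw [heatMoment_coe]
  have hKb : ∀ x' y, |x' - x| ≤ 1 → |K (y - x')| ≤ (|a| + |b|) * heatMajorant s x y := by
    intro x' y hx'
    have hj : ∀ j ≤ 2, |heatKernel j s (y - x')| ≤ heatMajorant s x y := fun j hj =>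
      abs_heatKernel_le hj hs hs (by linarith) hx'
    rcases hab (y - x') with h | h <;> rw [h]
    · refine (abs_add_le _ _).trans ?_
      rw [abs_mul, abs_mul, add_mul]
      gcongr
      exacts [hj 0 (by simp), hj 2 le_rfl]
    · refine (abs_add_le _ _).trans ?_
      rw [abs_mul, abs_mul, add_mul]
      gcongr
      exacts [hj 1 (by simp), hj 2 le_rfl]
  refine (hasDerivAt_integral_of_dominated_loc_of_deriv_le (s := Metric.closedBall x 1)
    (bound := fun y => (|a| + |b|) * heatMajorant s x y) (F' := fun x' y => f y * K (y - x'))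
    (Metric.closedBall_mem_nhds x one_pos)
    (Eventually.of_forall fun x' => aestronglyMeasurable_mul_heatKernel hf k s x')
    (integrable_mul_heatKernel hf hb hk hs x)
    ((measurable_lift hf).mul (hK.comp
      (continuous_id.sub continuous_const)).measurable).aestronglyMeasurable
    (Eventually.of_forall fun y x' hx' => ?_)
    ((integrable_heatMajorant hs x).const_mul _)
    (Eventually.of_forall fun y x' hx' => ?_)).2
  · rw [Real.norm_eq_abs, abs_mul]
    calc |f y| * |K (y - x')| ≤ 1 * |K (y - x')| := by gcongr; exact hb _
      _ ≤ _ := by rw [one_mul]; exact hKb x' y hx'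
  · have := (hd (y - x')).comp x' ((hasDerivAt_id x').const_sub y)
    simpa using this.const_mul (f y)

theorem hasDerivAt_heatKernel_zero {s : ℝ} (hs : 0 < s) (w : ℝ) :
    HasDerivAt (heatKernel 0 s) (-(heatKernel 1 s w / s)) w := by
  unfold heatKernel
  have h : HasDerivAt (fun w : ℝ => -w ^ 2 / (2 * s)) (-(w / s)) w := by
    have := ((hasDerivAt_pow 2 w).neg).div_const (2 * s)
    refine this.congr_deriv ?_
    simp only [Nat.cast_ofNat, Nat.add_one_sub_one, pow_one]
    field_simp
  have := h.exp
  simp only [pow_zero, one_mul, pow_one]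
  convert this using 1
  field_simp

theorem hasDerivAt_heatKernel_one {s : ℝ} (hs : 0 < s) (w : ℝ) :
    HasDerivAt (heatKernel 1 s) (-(heatKernel 2 s w / s - heatKernel 0 s w)) w := by
  have h := (hasDerivAt_id w).mul (hasDerivAt_heatKernel_zero hs w)
  have he : heatKernel 1 s = fun w => id w * heatKernel 0 s w := by
    funext w; simp [heatKernel]
  rw [he]
  refine h.congr_deriv ?_
  simp only [heatKernel, pow_zero, one_mul, id, pow_one]
  field_simp
  ring

theorem hasDerivAt_heatMoment_zero (hf : Measurable f) (hb : ∀ θ, |f θ| ≤ 1) {s : ℝ}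
    (hs : 0 < s) (x : ℝ) :
    HasDerivAt (fun x : ℝ => heatMoment 0 s f x) (heatMoment 1 s f x / s) x := by
  have := hasDerivAt_heatMoment_of_kernel hf hb (k := 0) (by simp) hs
    (K := fun w => heatKernel 1 s w / s) ((continuous_heatKernel 1 s).div_const s) (a := 1 / s)
    (b := 0) (fun w => Or.inr (by ring)) (hasDerivAt_heatKernel_zero hs) x
  convert this using 1
  rw [heatMoment_coe, ← integral_div]
  simp_rw [mul_div_assoc]

theorem hasDerivAt_heatMoment_one (hf : Measurable f) (hb : ∀ θ, |f θ| ≤ 1) {s : ℝ}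
    (hs : 0 < s) (x : ℝ) :
    HasDerivAt (fun x : ℝ => heatMoment 1 s f x)
      (heatMoment 2 s f x / s - heatMoment 0 s f x) x := by
  have := hasDerivAt_heatMoment_of_kernel hf hb (k := 1) (by simp) hs
    (K := fun w => heatKernel 2 s w / s - heatKernel 0 s w)
    (((continuous_heatKernel 2 s).div_const s).sub (continuous_heatKernel 0 s)) (a := -1)
    (b := 1 / s) (fun w => Or.inl (by ring)) (hasDerivAt_heatKernel_one hs) x
  convert this using 1
  rw [heatMoment_coe, heatMoment_coe, ← integral_div, ← integral_sub
    ((integrable_mul_heatKernel hf hb le_rfl hs x).div_const s)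
    (integrable_mul_heatKernel hf hb (by simp) hs x)]
  congr 1; funext y; ring

theorem hasDerivAt_heatMoment_time (hf : Measurable f) (hb : ∀ θ, |f θ| ≤ 1) {s : ℝ}
    (hs : 0 < s) (θ : UnitAddCircle) :
    HasDerivAt (fun s : ℝ => heatMoment 0 s f θ) (heatMoment 2 s f θ / (2 * s ^ 2)) s := by
  obtain ⟨x, rfl⟩ := QuotientAddGroup.mk_surjective θ
  simp_rw [heatMoment_coe]
  rw [← integral_div]
  simp_rw [mul_div_assoc]
  -- The upper end is what the majorant allows; the lower end gives `1 / (2 s'²) ≤ 2 / s²`, hence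
  -- the factor in the bound.
  have hmem : Icc (s / 2) (2 * s) ∈ 𝓝 s := Icc_mem_nhds (by linarith) (by linarith)
  refine (hasDerivAt_integral_of_dominated_loc_of_deriv_le (s := Icc (s / 2) (2 * s))
    (bound := fun y => heatMajorant s x y * (2 / s ^ 2))
    (F' := fun s' y => f y * (heatKernel 2 s' (y - x) / (2 * s' ^ 2))) hmem
    (Eventually.of_forall fun s' => aestronglyMeasurable_mul_heatKernel hf 0 s' x)
    (integrable_mul_heatKernel hf hb (by simp) hs x) ?_
    (Eventually.of_forall fun y s' hs' => ?_)
    ((integrable_heatMajorant hs x).mul_const _)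
    (Eventually.of_forall fun y s' hs' => ?_)).2
  · simp_rw [← mul_div_assoc]
    exact ((aestronglyMeasurable_mul_heatKernel hf 2 s x).aemeasurable.div_const _).aestronglyMeasurable
  · have hs0 : 0 < s' := by linarith [hs'.1]
    rw [← mul_div_assoc, norm_div, div_eq_mul_inv]
    refine mul_le_mul (norm_mul_heatKernel_le hb le_rfl hs hs0 hs'.2 (by simp)) ?_
      (by positivity) (by unfold heatMajorant; positivity)
    rw [Real.norm_of_nonneg (by positivity), inv_eq_one_div, div_le_div_iff₀ (by positivity)
      (by positivity)]
    nlinarith [hs'.1]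
  · have hs0 : 0 < s' := by linarith [hs'.1]
    refine HasDerivAt.const_mul _ ?_
    unfold heatKernel
    have h : HasDerivAt (fun s' : ℝ => -(y - x) ^ 2 / (2 * s')) ((y - x) ^ 2 / (2 * s' ^ 2)) s' := by
      have := ((hasDerivAt_inv hs0.ne').const_mul (-(y - x) ^ 2 / 2))
      refine (this.congr_of_eventuallyEq (Eventually.of_forall fun u => ?_)).congr_deriv ?_
      · simp only; rw [div_mul_eq_div_div, div_eq_mul_inv]
      · field_simp
    have := h.exp
    simp only [pow_zero, one_mul]
    refine this.congr_deriv ?_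
    ring

end regularity

/-- The normalisation of the Gaussian density of variance `s`. -/
def heatNorm (s : ℝ) : ℝ := (√(2 * Real.pi * s))⁻¹

/-- The first space derivative of `heat s f`. -/
def heatDx (s : ℝ) (f : UnitAddCircle → ℝ) (θ : UnitAddCircle) : ℝ :=
  heatNorm s * (heatMoment 1 s f θ / s)

/-- The second space derivative of `heat s f`. -/
def heatDxx (s : ℝ) (f : UnitAddCircle → ℝ) (θ : UnitAddCircle) : ℝ :=
  heatNorm s * ((heatMoment 2 s f θ / s - heatMoment 0 s f θ) / s)

theorem heatNorm_pos {s : ℝ} (hs : 0 < s) : 0 < heatNorm s := by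
  unfold heatNorm; positivity

theorem heat_eq_moment {s : ℝ} (hs : 0 < s) (f : UnitAddCircle → ℝ) (θ : UnitAddCircle) :
    heat s f θ = heatNorm s * heatMoment 0 s f θ := by
  rw [heat, integral_gaussianReal_eq_integral_smul (by simpa using hs), heatMoment,
    ← integral_const_mul]
  congr 1
  funext z
  simp only [gaussianPDFReal, heatKernel, heatNorm, Real.coe_toNNReal s hs.le, smul_eq_mul]
  ring_nf

/-- The Gaussian law of variance zero is the Dirac mass, so the backward flow ends at `f` itself,
pointwise and without a limit. -/
theorem heat_zero (f : UnitAddCircle → ℝ) : heat 0 f = f := by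
  funext θ
  simp [heat]

/-! ### Heat equation, positivity, contraction and smoothing -/

section semigroup

variable {f g : UnitAddCircle → ℝ}

theorem continuousOn_heatNorm : ContinuousOn heatNorm (Ioi 0) := by
  unfold heatNorm
  refine ContinuousOn.inv₀ (by fun_prop) fun s hs => ?_
  have : 0 < s := hs
  positivity

theorem continuousOn_heatNorm_fst :
    ContinuousOn (fun p : ℝ × UnitAddCircle => heatNorm p.1) (Ioi 0 ×ˢ univ) :=
  continuousOn_heatNorm.comp continuousOn_fst fun _ hp => hp.1

theorem continuousOn_heat (hf : Measurable f) (hb : ∀ θ, |f θ| ≤ 1) :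
    ContinuousOn (fun p : ℝ × UnitAddCircle => heat p.1 f p.2) (Ioi 0 ×ˢ univ) :=
  (continuousOn_heatNorm_fst.mul (continuousOn_heatMoment hf hb (k := 0) (by simp))).congr
    fun p hp => heat_eq_moment hp.1 f p.2

theorem continuousOn_heatDx (hf : Measurable f) (hb : ∀ θ, |f θ| ≤ 1) :
    ContinuousOn (fun p : ℝ × UnitAddCircle => heatDx p.1 f p.2) (Ioi 0 ×ˢ univ) :=
  continuousOn_heatNorm_fst.mul ((continuousOn_heatMoment hf hb (k := 1) (by simp)).div
    continuousOn_fst fun _ hp => ne_of_gt (mem_Ioi.1 hp.1))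

theorem continuousOn_heatDxx (hf : Measurable f) (hb : ∀ θ, |f θ| ≤ 1) :
    ContinuousOn (fun p : ℝ × UnitAddCircle => heatDxx p.1 f p.2) (Ioi 0 ×ˢ univ) :=
  continuousOn_heatNorm_fst.mul ((((continuousOn_heatMoment hf hb (k := 2) le_rfl).div
    continuousOn_fst fun _ hp => ne_of_gt (mem_Ioi.1 hp.1)).sub
    (continuousOn_heatMoment hf hb (k := 0) (by simp))).div
    continuousOn_fst fun _ hp => ne_of_gt (mem_Ioi.1 hp.1))

theorem hasDerivAt_heat (hf : Measurable f) (hb : ∀ θ, |f θ| ≤ 1) {s : ℝ} (hs : 0 < s) (x : ℝ) :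
    HasDerivAt (fun x : ℝ => heat s f x) (heatDx s f x) x := by
  simp_rw [heat_eq_moment hs]
  exact (hasDerivAt_heatMoment_zero hf hb hs x).const_mul _

theorem hasDerivAt_heatDx (hf : Measurable f) (hb : ∀ θ, |f θ| ≤ 1) {s : ℝ} (hs : 0 < s)
    (x : ℝ) : HasDerivAt (fun x : ℝ => heatDx s f x) (heatDxx s f x) x :=
  ((hasDerivAt_heatMoment_one hf hb hs x).div_const s).const_mul _

theorem hasDerivAt_heatNorm {s : ℝ} (hs : 0 < s) :
    HasDerivAt heatNorm (-(heatNorm s / (2 * s))) s := by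
  have h0 : 0 < 2 * Real.pi * s := by positivity
  have h1 : HasDerivAt (fun s : ℝ => 2 * Real.pi * s) (2 * Real.pi) s := by
    simpa using (hasDerivAt_id s).const_mul (2 * Real.pi)
  refine ((h1.sqrt h0.ne').inv (Real.sqrt_pos.2 h0).ne').congr_deriv ?_
  have h2 := Real.sq_sqrt h0.le
  have h3 : √(2 * Real.pi * s) ≠ 0 := (Real.sqrt_pos.2 h0).ne'
  rw [heatNorm, h2]
  field_simp

/-- The normalisation contributes the zeroth moment and the exponential the second one; together
they form half the second space derivative. -/
theorem hasDerivAt_heat_time (hf : Measurable f) (hb : ∀ θ, |f θ| ≤ 1) {s : ℝ} (hs : 0 < s)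
    (θ : UnitAddCircle) : HasDerivAt (fun s : ℝ => heat s f θ) (1 / 2 * heatDxx s f θ) s := by
  have h := (hasDerivAt_heatNorm hs).mul (hasDerivAt_heatMoment_time hf hb hs θ)
  refine (h.congr_of_eventuallyEq ?_).congr_deriv ?_
  · filter_upwards [Ioi_mem_nhds hs] with u hu
    exact heat_eq_moment hu f θ
  · unfold heatDxx
    field_simp
    ring

theorem measurable_shift (hf : Measurable f) :
    Measurable fun p : UnitAddCircle × ℝ => f (p.1 + (p.2 : UnitAddCircle)) :=
  hf.comp (measurable_fst.add ((AddCircle.continuous_mk' 1).measurable.comp measurable_snd))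

theorem integrable_shift (hf : Measurable f) (hb : ∀ θ, |f θ| ≤ 1) (s : ℝ) (θ : UnitAddCircle) :
    Integrable (fun z : ℝ => f (θ + (z : UnitAddCircle))) (gaussianReal 0 s.toNNReal) :=
  Integrable.of_bound ((measurable_shift hf).comp measurable_prodMk_left).aestronglyMeasurable 1
    (Eventually.of_forall fun _ => hb _)

theorem measurable_heat (hf : Measurable f) (s : ℝ) : Measurable (heat s f) :=
  ((measurable_shift hf).stronglyMeasurable.integral_prod_right
    (ν := gaussianReal 0 s.toNNReal)).measurable

theorem heat_sub (hf : Measurable f) (hfb : ∀ θ, |f θ| ≤ 1) (hg : Measurable g)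
    (hgb : ∀ θ, |g θ| ≤ 1) (s : ℝ) (θ : UnitAddCircle) :
    heat s (fun θ => f θ - g θ) θ = heat s f θ - heat s g θ :=
  integral_sub (integrable_shift hf hfb s θ) (integrable_shift hg hgb s θ)

theorem heat_const_sub (hf : Measurable f) (hfb : ∀ θ, |f θ| ≤ 1) (s : ℝ) (θ : UnitAddCircle) :
    heat s (fun θ => 1 - f θ) θ = 1 - heat s f θ := by
  rw [heat_sub measurable_const (by simp) hf hfb]
  simp [heat]

theorem integrable_moment (hf : Measurable f) (hfb : ∀ θ, |f θ| ≤ 1) {k : ℕ} (hk : k ≤ 2) {s : ℝ}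
    (hs : 0 < s) (θ : UnitAddCircle) :
    Integrable fun z : ℝ => f (θ + (z : UnitAddCircle)) * heatKernel k s z := by
  obtain ⟨x, rfl⟩ := QuotientAddGroup.mk_surjective θ
  have := (integrable_mul_heatKernel hf hfb hk hs x).comp_add_left x
  simpa using this

theorem heatDx_sub (hf : Measurable f) (hfb : ∀ θ, |f θ| ≤ 1) (hg : Measurable g)
    (hgb : ∀ θ, |g θ| ≤ 1) {s : ℝ} (hs : 0 < s) (θ : UnitAddCircle) :
    heatDx s (fun θ => f θ - g θ) θ = heatDx s f θ - heatDx s g θ := by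
  have : heatMoment 1 s (fun θ => f θ - g θ) θ = heatMoment 1 s f θ - heatMoment 1 s g θ := by
    unfold heatMoment
    simp_rw [sub_mul]
    exact integral_sub (integrable_moment hf hfb (by simp) hs θ)
      (integrable_moment hg hgb (by simp) hs θ)
  unfold heatDx
  rw [this]
  ring

theorem heat_nonneg (h0 : ∀ θ, 0 ≤ f θ) (s : ℝ) (θ : UnitAddCircle) : 0 ≤ heat s f θ :=
  integral_nonneg fun _ => h0 _

theorem abs_le_one_of_mem_Icc (h : ∀ θ, f θ ∈ Icc (0 : ℝ) 1) (θ : UnitAddCircle) : |f θ| ≤ 1 :=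
  abs_le.2 ⟨by linarith [(h θ).1], (h θ).2⟩

theorem heat_mem_Icc (hf : Measurable f) (h : ∀ θ, f θ ∈ Icc (0 : ℝ) 1) (s : ℝ)
    (θ : UnitAddCircle) : heat s f θ ∈ Icc (0 : ℝ) 1 := by
  refine ⟨heat_nonneg (fun θ => (h θ).1) s θ, ?_⟩
  have := heat_nonneg (f := fun θ => 1 - f θ) (fun θ => by linarith [(h θ).2]) s θ
  rw [heat_const_sub hf (abs_le_one_of_mem_Icc h)] at this
  linarith

/-- The strong maximum principle: a nonnegative solution that vanishes somewhere is zero. -/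
theorem heat_pos_of_pos (hf : Measurable f) (hb : ∀ θ, |f θ| ≤ 1) (h0 : ∀ θ, 0 ≤ f θ) {s s' : ℝ}
    (hs : 0 < s) (hs' : 0 < s') {θ θ' : UnitAddCircle} (h : 0 < heat s f θ) :
    0 < heat s' f θ' := by
  refine (heat_nonneg h0 s' θ').lt_of_ne fun hz => ?_
  obtain ⟨x, rfl⟩ := QuotientAddGroup.mk_surjective θ
  obtain ⟨x', rfl⟩ := QuotientAddGroup.mk_surjective θ'
  have hker : ∀ s w, 0 < heatKernel 0 s w := fun s w => by unfold heatKernel; positivity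
  have hm : heatMoment 0 s' f (x' : UnitAddCircle) = 0 := by
    have := heat_eq_moment hs' f (x' : UnitAddCircle)
    have h1 := heatNorm_pos hs'
    have h2 : heatNorm s' * heatMoment 0 s' f (x' : UnitAddCircle) = 0 := this.symm.trans hz.symm
    exact (mul_eq_zero.1 h2).resolve_left h1.ne'
  -- The kernel is positive, so a vanishing integral forces `f = 0` almost everywhere on the line,
  -- whence every other value of the flow at a positive time vanishes too.
  rw [heatMoment_coe, integral_eq_zero_iff_of_nonneg
    (fun y => mul_nonneg (h0 _) (hker _ _).le)
    (integrable_mul_heatKernel hf hb (by simp) hs' x')] at hm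
  have : heatMoment 0 s f (x : UnitAddCircle) = 0 := by
    rw [heatMoment_coe]
    refine integral_eq_zero_of_ae ?_
    filter_upwards [hm] with y hy
    have : f y = 0 := (mul_eq_zero.1 hy).resolve_right (hker _ _).ne'
    simp [this]
  have h3 : heat s f (x : UnitAddCircle) = 0 := by rw [heat_eq_moment hs, this, mul_zero]
  exact h.ne' h3

theorem integral_sq_gaussianReal {s : ℝ} (hs : 0 ≤ s) :
    ∫ z, z ^ 2 ∂(gaussianReal 0 s.toNNReal) = s := by
  have h := variance_of_integral_eq_zero (X := fun z : ℝ => z) (μ := gaussianReal 0 s.toNNReal)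
    aemeasurable_id integral_id_gaussianReal
  rw [variance_fun_id_gaussianReal] at h
  rw [← h, Real.coe_toNNReal s hs]

theorem integrable_sq_gaussianReal (s : ℝ) :
    Integrable (fun z : ℝ => z ^ 2) (gaussianReal 0 s.toNNReal) :=
  (memLp_id_gaussianReal 2).integrable_sq

theorem abs_shift_sub_le {η C : ℝ} (hC : 0 ≤ C) (hmod : ∀ x y, |g x - g y| ≤ η + C * dist x y ^ 2)
    (θ : UnitAddCircle) (z : ℝ) : |g (θ + (z : UnitAddCircle)) - g θ| ≤ η + C * z ^ 2 := by
  refine (hmod _ _).trans ?_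
  gcongr η + C * ?_
  rw [dist_eq_norm, add_sub_cancel_left, ← sq_abs z]
  have : ‖(z : UnitAddCircle)‖ ≤ |z| := QuotientAddGroup.norm_mk_le_norm
  gcongr

/-- The quadratic modulus is averaged over a centred Gaussian of variance `s`. -/
theorem abs_heat_sub_le (hg : Measurable g) (hb : ∀ θ, |g θ| ≤ 1) {η C : ℝ} (hC : 0 ≤ C)
    (hmod : ∀ x y, |g x - g y| ≤ η + C * dist x y ^ 2) {s : ℝ} (hs : 0 ≤ s) (θ : UnitAddCircle) :
    |heat s g θ - g θ| ≤ η + C * s := by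
  have h1 : heat s g θ - g θ
      = ∫ z : ℝ, (g (θ + (z : UnitAddCircle)) - g θ) ∂(gaussianReal 0 s.toNNReal) := by
    rw [integral_sub (integrable_shift hg hb s θ) (integrable_const _)]
    simp [heat]
  have h2 : ∫ z, (η + C * z ^ 2) ∂(gaussianReal 0 s.toNNReal) = η + C * s := by
    rw [integral_add (integrable_const _) ((integrable_sq_gaussianReal s).const_mul C),
      integral_const_mul, integral_sq_gaussianReal hs]
    simp
  rw [h1, ← h2, ← Real.norm_eq_abs]
  exact norm_integral_le_of_norm_le
    ((integrable_const _).add ((integrable_sq_gaussianReal s).const_mul C))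
    (Eventually.of_forall fun z => abs_shift_sub_le hC hmod θ z)

theorem integrable_of_measurable_bound {C : ℝ} (hf : Measurable f) (hb : ∀ θ, |f θ| ≤ C) :
    Integrable f :=
  Integrable.of_bound hf.aestronglyMeasurable C (Eventually.of_forall hb)

theorem integrable_shift_prod (hf : Measurable f) (hb : ∀ θ, |f θ| ≤ 1) (s : ℝ) :
    Integrable (Function.uncurry fun (θ : UnitAddCircle) (z : ℝ) => f (θ + (z : UnitAddCircle)))
      (volume.prod (gaussianReal 0 s.toNNReal)) :=
  Integrable.of_bound (measurable_shift hf).aestronglyMeasurable 1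
    (Eventually.of_forall fun _ => hb _)

/-- The heat semigroup is a contraction in `L¹`. -/
theorem integral_abs_heat_le (hf : Measurable f) (hb : ∀ θ, |f θ| ≤ 1) (s : ℝ) :
    ∫ θ, |heat s f θ| ≤ ∫ θ, |f θ| := by
  have hf' : Measurable fun θ => |f θ| := hf.abs
  have hb' : ∀ θ, |(|f θ|)| ≤ 1 := fun θ => by rw [abs_abs]; exact hb θ
  calc ∫ θ, |heat s f θ| ≤ ∫ θ, heat s (fun θ => |f θ|) θ := by
        refine integral_mono_of_nonneg (Eventually.of_forall fun _ => abs_nonneg _)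
          ((integrable_shift_prod hf' hb' s).integral_prod_left)
          (Eventually.of_forall fun θ => ?_)
        exact norm_integral_le_integral_norm (μ := gaussianReal 0 s.toNNReal)
          (fun z : ℝ => f (θ + (z : UnitAddCircle)))
    _ = ∫ z : ℝ, (∫ θ, |f (θ + (z : UnitAddCircle))|) ∂(gaussianReal 0 s.toNNReal) :=
        integral_integral_swap (integrable_shift_prod hf' hb' s)
    _ = ∫ θ, |f θ| := by
        simp_rw [integral_add_right_eq_self (fun θ => |f θ|)]
        simp

/-- The heat semigroup is weakly continuous at time zero. -/
theorem abs_integral_mul_heat_sub_le (hf : Measurable f) (hb : ∀ θ, |f θ| ≤ 1)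
    (hg : Continuous g) {η C : ℝ} (hC : 0 ≤ C)
    (hmod : ∀ x y, |g x - g y| ≤ η + C * dist x y ^ 2) {s : ℝ} (hs : 0 ≤ s) :
    |(∫ θ, g θ * heat s f θ) - ∫ θ, g θ * f θ| ≤ η + C * s := by
  obtain ⟨K, hK⟩ := (isCompact_range hg.norm).bddAbove
  have hgK : ∀ θ, |g θ| ≤ K := fun θ => hK ⟨θ, rfl⟩
  have hK0 : 0 ≤ K := (abs_nonneg _).trans (hgK 0)
  have hint : Integrable (Function.uncurry fun (θ : UnitAddCircle) (z : ℝ) =>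
      g θ * f (θ + (z : UnitAddCircle))) (volume.prod (gaussianReal 0 s.toNNReal)) := by
    refine Integrable.of_bound ((hg.measurable.comp measurable_fst).mul
      (measurable_shift hf)).aestronglyMeasurable K (Eventually.of_forall fun p => ?_)
    rw [Function.uncurry, norm_mul]
    calc _ ≤ K * 1 := mul_le_mul (hgK _) (hb _) (abs_nonneg _) hK0
      _ = K := mul_one K
  -- Translation invariance moves the shift from the measurable `f` to the continuous `g`, which has
  -- a modulus.
  have h1 : ∫ θ, g θ * heat s f θ
      = ∫ z : ℝ, (∫ θ, g (θ + ((-z : ℝ) : UnitAddCircle)) * f θ) ∂(gaussianReal 0 s.toNNReal) := by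
    simp_rw [heat, ← integral_const_mul]
    rw [integral_integral_swap hint]
    refine integral_congr_ae (Eventually.of_forall fun z => ?_)
    simp only
    rw [← integral_add_right_eq_self (fun θ => g (θ + ((-z : ℝ) : UnitAddCircle)) * f θ)
      (z : UnitAddCircle)]
    simp
  have hgf : ∀ z : ℝ, Integrable fun θ => g (θ + (z : UnitAddCircle)) * f θ := fun z =>
    integrable_of_measurable_bound (C := K) ((by fun_prop : Continuous fun θ =>
      g (θ + (z : UnitAddCircle))).measurable.mul hf) fun θ => by
      rw [abs_mul]
      calc _ ≤ K * 1 := mul_le_mul (hgK _) (hb _) (abs_nonneg _) hK0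
        _ = K := mul_one K
  have hz : ∀ z : ℝ, |(∫ θ, g (θ + ((-z : ℝ) : UnitAddCircle)) * f θ) - ∫ θ, g θ * f θ|
      ≤ η + C * z ^ 2 := fun z => by
    have h0 : Integrable fun θ => g θ * f θ := integrable_of_measurable_bound (C := K)
      (hg.measurable.mul hf) fun θ => by
      rw [abs_mul]
      calc _ ≤ K * 1 := mul_le_mul (hgK _) (hb _) (abs_nonneg _) hK0
        _ = K := mul_one K
    rw [← integral_sub (hgf (-z)) h0, ← Real.norm_eq_abs]
    refine (norm_integral_le_of_norm_le_const (μ := (volume : Measure UnitAddCircle))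
      (C := η + C * z ^ 2) (Eventually.of_forall fun θ => ?_)).trans (le_of_eq (by simp [measureReal_def]))
    rw [← sub_mul, norm_mul]
    calc _ ≤ (η + C * (-z) ^ 2) * 1 := mul_le_mul (abs_shift_sub_le hC hmod θ (-z)) (hb _)
          (abs_nonneg _) ((abs_nonneg _).trans (abs_shift_sub_le hC hmod θ (-z)))
      _ = _ := by ring
  have h2 : ∫ z, (η + C * z ^ 2) ∂(gaussianReal 0 s.toNNReal) = η + C * s := by
    rw [integral_add (integrable_const _) ((integrable_sq_gaussianReal s).const_mul C),
      integral_const_mul, integral_sq_gaussianReal hs]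
    simp
  have hint2 : Integrable (fun z : ℝ => ∫ θ, g (θ + ((-z : ℝ) : UnitAddCircle)) * f θ)
      (gaussianReal 0 s.toNNReal) := by
    refine hint.integral_prod_right.congr (Eventually.of_forall fun z => ?_)
    simp only [Function.uncurry]
    rw [← integral_add_right_eq_self (fun θ => g (θ + ((-z : ℝ) : UnitAddCircle)) * f θ)
      (z : UnitAddCircle)]
    simp
  have h3 : (∫ θ, g θ * heat s f θ) - ∫ θ, g θ * f θ
      = ∫ z : ℝ, ((∫ θ, g (θ + ((-z : ℝ) : UnitAddCircle)) * f θ) - ∫ θ, g θ * f θ)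
        ∂(gaussianReal 0 s.toNNReal) := by
    rw [integral_sub hint2 (integrable_const _), h1]
    simp
  rw [h3, ← h2, ← Real.norm_eq_abs]
  exact norm_integral_le_of_norm_le
    ((integrable_const _).add ((integrable_sq_gaussianReal s).const_mul C))
    (Eventually.of_forall hz)

/-- The heat flow averages translates, so it preserves the Lipschitz constant. The bound does not
degenerate as `s → 0`. -/
theorem abs_heatDx_le_of_lipschitz (hf : Measurable f) (hb : ∀ θ, |f θ| ≤ 1) {L : ℝ}
    (hL : 0 ≤ L) (hlip : ∀ x y : ℝ, |f x - f y| ≤ L * |x - y|) {s : ℝ} (hs : 0 < s)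
    (θ : UnitAddCircle) : |heatDx s f θ| ≤ L := by
  obtain ⟨x, rfl⟩ := QuotientAddGroup.mk_surjective θ
  refine (hasDerivAt_heat hf hb hs x).le_of_lip' hL (Eventually.of_forall fun y => ?_)
  have : heat s f y - heat s f x = ∫ z : ℝ, (f ((y + z : ℝ) : UnitAddCircle)
      - f ((x + z : ℝ) : UnitAddCircle)) ∂(gaussianReal 0 s.toNNReal) :=
    (integral_sub (integrable_shift hf hb s y) (integrable_shift hf hb s x)).symm
  rw [this]
  refine (norm_integral_le_of_norm_le_const (C := L * |y - x|)
    (Eventually.of_forall fun z => ?_)).trans (by simp)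
  simpa using hlip (y + z) (x + z)

/-- A smoothing estimate: the moments are uniformly small if `f` is small in `L¹`. -/
theorem exists_abs_heatMoment_le {k : ℕ} (hk : k ≤ 2) {s : ℝ} (hs : 0 < s) {η : ℝ} (hη : 0 < η) :
    ∃ C, 0 ≤ C ∧ ∀ f : UnitAddCircle → ℝ, Measurable f → (∀ θ, |f θ| ≤ 1) →
      ∀ θ, |heatMoment k s f θ| ≤ η + C * ∫ θ, |f θ| := by
  have hKi : Integrable fun z => |heatKernel k s z| := by
    have := integrable_moment (f := fun _ => 1) measurable_const (by simp) hk hs 0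
    simpa using this.abs
  -- Truncation: outside `[-N, N]` the kernel has mass less than `η` and `|f| ≤ 1`; inside, the
  -- kernel is at most `K`, and the periodic function `|f|` integrates to `2N` times its mean.
  have hlim := intervalIntegral_tendsto_integral hKi
    (tendsto_neg_atTop_atBot.comp tendsto_natCast_atTop_atTop) tendsto_natCast_atTop_atTop
  obtain ⟨N, hN⟩ := (hlim.eventually (lt_mem_nhds (sub_lt_self _ hη))).exists
  have hbd : ∀ z, |heatKernel k s z| ≤ (1 + 8 * s) * Real.exp (1 / (8 * s)) := fun z => by
    have h := abs_heatKernel_le hk hs hs (by linarith) (x₀ := 0) (x := 0) (y := z) (by simp)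
    rw [sub_zero] at h
    refine h.trans ?_
    unfold heatMajorant
    refine mul_le_of_le_one_right (by positivity) (Real.exp_le_one_iff.2 ?_)
    have : 0 ≤ 1 / (16 * s) * (z - 0) ^ 2 := by positivity
    linarith
  set K := (1 + 8 * s) * Real.exp (1 / (8 * s)) with hKdef
  have hK0 : 0 ≤ K := by positivity
  refine ⟨K * (2 * N), by positivity, fun f hf hb θ => ?_⟩
  set F : ℝ → ℝ := fun z => |f (θ + (z : UnitAddCircle))| with hF
  have hFm : Measurable F := ((measurable_shift hf).comp measurable_prodMk_left).abs
  have hFb : ∀ z, |F z| ≤ 1 := fun z => by rw [hF]; simp only [abs_abs]; exact hb _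
  have hF0 : ∀ z, 0 ≤ F z := fun z => abs_nonneg _
  have hF1 : ∀ z, F z ≤ 1 := fun z => hb _
  have hFI : ∀ a b : ℝ, IntervalIntegrable F volume a b := fun a b =>
    (intervalIntegrable_const (c := (1 : ℝ))).mono_fun' hFm.aestronglyMeasurable
      (Eventually.of_forall hFb)
  have hFK : Integrable fun z => F z * |heatKernel k s z| := by
    have := (integrable_moment hf hb hk hs θ).abs
    simpa [abs_mul] using this
  have hper : Function.Periodic F 1 := fun z => by
    simp only [hF, AddCircle.coe_add]
    rw [show ((1 : ℝ) : UnitAddCircle) = 0 from AddCircle.coe_period (1 : ℝ), add_zero]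
  have hFint : ∫ z in (-(N : ℝ))..N, F z = 2 * N * ∫ θ, |f θ| := by
    have h := hper.intervalIntegral_add_zsmul_eq (2 * N) (-N) hFI
    have h1 : (-(N : ℝ)) + (2 * N : ℤ) • (1 : ℝ) = N := by simp; ring
    rw [h1, zsmul_eq_mul] at h
    rw [h, UnitAddCircle.intervalIntegral_preimage (-N) (fun φ => |f (θ + φ)|),
      integral_add_left_eq_self (fun φ => |f φ|) θ]
    push_cast; ring
  have hNN : (-(N : ℝ)) ≤ N := by linarith [Nat.cast_nonneg (α := ℝ) N]
  have hsplit : (∫ z, F z * |heatKernel k s z|) - ∫ z in (-(N : ℝ))..N, F z * |heatKernel k s z|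
      ≤ (∫ z, |heatKernel k s z|) - ∫ z in (-(N : ℝ))..N, |heatKernel k s z| := by
    rw [sub_le_sub_iff, intervalIntegral.integral_of_le hNN, intervalIntegral.integral_of_le hNN,
      ← integral_add_compl (measurableSet_Ioc (a := -(N : ℝ)) (b := N)) hFK,
      ← integral_add_compl (measurableSet_Ioc (a := -(N : ℝ)) (b := N)) hKi]
    have : ∫ z in (Ioc (-(N : ℝ)) N)ᶜ, F z * |heatKernel k s z|
        ≤ ∫ z in (Ioc (-(N : ℝ)) N)ᶜ, |heatKernel k s z| :=
      integral_mono hFK.integrableOn hKi.integrableOn fun z =>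
        mul_le_of_le_one_left (abs_nonneg _) (hF1 z)
    linarith
  have hinner : ∫ z in (-(N : ℝ))..N, F z * |heatKernel k s z| ≤ K * ∫ z in (-(N : ℝ))..N, F z := by
    rw [← intervalIntegral.integral_const_mul]
    refine intervalIntegral.integral_mono_on hNN hFK.intervalIntegrable
      ((hFI _ _).const_mul K) fun z _ => ?_
    rw [mul_comm K]
    exact mul_le_mul_of_nonneg_left (hbd z) (hF0 z)
  have hmain : |heatMoment k s f θ| ≤ ∫ z, F z * |heatKernel k s z| := by
    refine (norm_integral_le_integral_norm (μ := volume)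
      fun z : ℝ => f (θ + (z : UnitAddCircle)) * heatKernel k s z).trans (le_of_eq ?_)
    simp [hF]
  simp only [Function.comp] at hN
  rw [hFint] at hinner
  nlinarith

end semigroup

/-! ### The action and the energy of a smooth piece of a path -/

/-- On `[a,b]`, the path `w` with values in `(0,1)` is of class `C¹` with derivatives
`wt` and `wx`. -/
structure SmoothPiece (a b : ℝ) (w wt wx : ℝ → UnitAddCircle → ℝ) : Prop where
  hasDeriv_t : ∀ t ∈ Icc a b, ∀ θ, HasDerivWithinAt (fun s => w s θ) (wt t θ) (Icc a b) t
  hasDeriv_x : ∀ t ∈ Icc a b, ∀ x : ℝ, HasDerivAt (fun y : ℝ => w t y) (wx t x) x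
  cont : ContinuousOn (Function.uncurry w) (Icc a b ×ˢ univ)
  cont_t : ContinuousOn (Function.uncurry wt) (Icc a b ×ˢ univ)
  cont_x : ContinuousOn (Function.uncurry wx) (Icc a b ×ˢ univ)
  mem : ∀ t ∈ Icc a b, ∀ θ, w t θ ∈ Ioo (0 : ℝ) 1

/-- The integrand (in time) of the action of a path with density `w`. -/
def actionDensity (B D : ℝ → ℝ) {T : ℝ} (G : Test12 T) (w : ℝ → UnitAddCircle → ℝ) (t : ℝ) : ℝ :=
  (∫ θ, (G.dt t θ + 1 / 2 * G.dxx t θ) * w t θ)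
    + 1 / 2 * (∫ θ, mobility (w t θ) * G.dx t θ ^ 2)
    + ((∫ θ, B (w t θ) * (Real.exp (G.val t θ) - 1))
      + ∫ θ, D (w t θ) * (Real.exp (-G.val t θ) - 1))

/-- The action on the time interval `[a,b]` of a path with density `w`. -/
def localAction (B D : ℝ → ℝ) {T : ℝ} (G : Test12 T) (w : ℝ → UnitAddCircle → ℝ) (a b : ℝ) : ℝ :=
  (∫ θ, G.val b θ * w b θ) - (∫ θ, G.val a θ * w a θ) - ∫ t in a..b, actionDensity B D G w t

/-- The integrand (in time) of the energy of a path with density `w`. -/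
def energyDensity {T : ℝ} (G : Test01 T) (w : ℝ → UnitAddCircle → ℝ) (t : ℝ) : ℝ :=
  2 * (∫ θ, w t θ * G.dx t θ) - ∫ θ, G.val t θ ^ 2

/-- The integrand (in time and space) of the action after integration by parts. -/
def actionGain (B D : ℝ → ℝ) {T : ℝ} (G : Test12 T) (w wt wx : ℝ → UnitAddCircle → ℝ) (t : ℝ)
    (θ : UnitAddCircle) : ℝ :=
  wt t θ * G.val t θ + 1 / 2 * (wx t θ * G.dx t θ)
    - 1 / 2 * (mobility (w t θ) * G.dx t θ ^ 2)
    - B (w t θ) * (Real.exp (G.val t θ) - 1) - D (w t θ) * (Real.exp (-G.val t θ) - 1)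

theorem integral_torus_const (c : ℝ) : ∫ _ : UnitAddCircle, c = c := by simp [measureReal_def]

theorem continuous_mobility : Continuous mobility := by unfold mobility; fun_prop

theorem uncurry_comp_continuousOn {S : Set (ℝ × UnitAddCircle)} {w : ℝ → UnitAddCircle → ℝ}
    {Ψ : ℝ → ℝ} (hΨ : Continuous Ψ) (hw : ContinuousOn (Function.uncurry w) S) :
    ContinuousOn (Function.uncurry fun t θ => Ψ (w t θ)) S :=
  hΨ.comp_continuousOn hw

theorem continuousOn_actionDensity {B D : ℝ → ℝ} (hB : Continuous B) (hD : Continuous D)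
    {S : Set ℝ} [LocallyCompactSpace S] {T : ℝ} (hS : S ⊆ Icc 0 T) (G : Test12 T)
    {w : ℝ → UnitAddCircle → ℝ} (hw : ContinuousOn (Function.uncurry w) (S ×ˢ univ)) :
    ContinuousOn (actionDensity B D G w) S := by
  have hsub : S ×ˢ (univ : Set UnitAddCircle) ⊆ Icc 0 T ×ˢ univ := prod_mono hS subset_rfl
  have hv := G.cont_val.mono hsub
  have ht := G.cont_dt.mono hsub
  have hx := G.cont_dx.mono hsub
  have hxx := G.cont_dxx.mono hsub
  have hBw := uncurry_comp_continuousOn hB hw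
  have hDw := uncurry_comp_continuousOn hD hw
  have hχw := uncurry_comp_continuousOn continuous_mobility hw
  refine ((continuousOn_integral_torus ?_).add
    (continuousOn_const.mul (continuousOn_integral_torus ?_))).add
    ((continuousOn_integral_torus ?_).add (continuousOn_integral_torus ?_))
  · exact (ht.add (hxx.const_mul (1 / 2))).mul hw
  · exact hχw.mul (hx.pow 2)
  · exact hBw.mul ((Real.continuous_exp.comp_continuousOn hv).sub continuousOn_const)
  · exact hDw.mul ((Real.continuous_exp.comp_continuousOn hv.neg).sub continuousOn_const)

section piece

variable {a b T : ℝ} {w wt wx : ℝ → UnitAddCircle → ℝ} {B D : ℝ → ℝ}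

theorem continuousOn_actionGain (hp : SmoothPiece a b w wt wx) (hB : Continuous B)
    (hD : Continuous D) (hsub : Icc a b ⊆ Icc 0 T) (G : Test12 T) :
    ContinuousOn (Function.uncurry (actionGain B D G w wt wx)) (Icc a b ×ˢ univ) := by
  have hsub' : Icc a b ×ˢ (univ : Set UnitAddCircle) ⊆ Icc 0 T ×ˢ univ := prod_mono hsub subset_rfl
  have hv := G.cont_val.mono hsub'
  have hx := G.cont_dx.mono hsub'
  have hBw := uncurry_comp_continuousOn hB hp.cont
  have hDw := uncurry_comp_continuousOn hD hp.cont
  have hχw := uncurry_comp_continuousOn continuous_mobility hp.cont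
  exact ((((hp.cont_t.mul hv).add ((hp.cont_x.mul hx).const_mul (1 / 2))).sub
    ((hχw.mul (hx.pow 2)).const_mul (1 / 2))).sub
    (hBw.mul ((Real.continuous_exp.comp_continuousOn hv).sub continuousOn_const))).sub
    (hDw.mul ((Real.continuous_exp.comp_continuousOn hv.neg).sub continuousOn_const))

/-- The boundary terms cancel `∂ₜG`, and `ΔG` is integrated by parts. What remains involves only the
values of `G` and `∇G`, so it can be bounded above pointwise. -/
theorem localAction_eq (hab : a ≤ b) (hp : SmoothPiece a b w wt wx) (hB : Continuous B)
    (hD : Continuous D) (hsub : Icc a b ⊆ Icc 0 T) (G : Test12 T) :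
    localAction B D G w a b = ∫ t in a..b, ∫ θ, actionGain B D G w wt wx t θ := by
  have hsub' : Icc a b ×ˢ (univ : Set UnitAddCircle) ⊆ Icc 0 T ×ˢ univ := prod_mono hsub subset_rfl
  have hφt : ContinuousOn (Function.uncurry fun t θ => G.dt t θ * w t θ + G.val t θ * wt t θ)
      (Icc a b ×ˢ univ) :=
    ((G.cont_dt.mono hsub').mul hp.cont).add ((G.cont_val.mono hsub').mul hp.cont_t)
  have hftc := integral_sub_eq_integral_deriv hab (φ := fun t θ => G.val t θ * w t θ)
    (φt := fun t θ => G.dt t θ * w t θ + G.val t θ * wt t θ)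
    (fun t ht θ => ((G.hasDeriv_dt t (hsub ht) θ).mono hsub).mul (hp.hasDeriv_t t ht θ))
    ((G.cont_val.mono hsub').mul hp.cont) hφt
  rw [localAction, hftc, ← intervalIntegral.integral_sub
    ((continuousOn_integral_torus hφt).intervalIntegrable_of_Icc hab)
    ((continuousOn_actionDensity hB hD hsub G hp.cont).intervalIntegrable_of_Icc hab)]
  refine intervalIntegral.integral_congr fun t ht => ?_
  rw [uIcc_of_le hab] at ht
  have hv := continuousOn_slice G.cont_val (hsub ht)
  have hdt := continuousOn_slice G.cont_dt (hsub ht)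
  have hx := continuousOn_slice G.cont_dx (hsub ht)
  have hxx := continuousOn_slice G.cont_dxx (hsub ht)
  have hw := continuousOn_slice hp.cont ht
  have hwt := continuousOn_slice hp.cont_t ht
  have hwx := continuousOn_slice hp.cont_x ht
  have hχ := continuous_mobility.comp hw
  have hBw := hB.comp hw
  have hDw := hD.comp hw
  simp only [Function.comp_def] at hχ hBw hDw
  have hibp : ∫ θ, w t θ * G.dxx t θ = -∫ θ, wx t θ * G.dx t θ :=
    integral_mul_deriv_torus (hp.hasDeriv_x t ht) hwx (G.hasDeriv_dxx t (hsub ht)) hxx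
  simp only [actionDensity, actionGain]
  rw [integral_sub (integrable_of_continuous (by fun_prop)) (integrable_of_continuous (by fun_prop)),
    integral_sub (integrable_of_continuous (by fun_prop)) (integrable_of_continuous (by fun_prop)),
    integral_sub (integrable_of_continuous (by fun_prop)) (integrable_of_continuous (by fun_prop)),
    integral_add (integrable_of_continuous (by fun_prop)) (integrable_of_continuous (by fun_prop)),
    integral_add (integrable_of_continuous (by fun_prop)) (integrable_of_continuous (by fun_prop)),
    integral_const_mul, integral_const_mul]
  have h1 : ∫ θ, (G.dt t θ + 1 / 2 * G.dxx t θ) * w t θ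
      = (∫ θ, G.dt t θ * w t θ) + 1 / 2 * ∫ θ, w t θ * G.dxx t θ := by
    rw [← integral_const_mul, ← integral_add (integrable_of_continuous (by fun_prop))
      (integrable_of_continuous (by fun_prop))]
    congr 1; funext θ; ring
  have h2 : ∫ θ, G.val t θ * wt t θ = ∫ θ, wt t θ * G.val t θ := by
    congr 1; funext θ; ring
  rw [h1, hibp, h2]
  ring

/-- The action of a piece with small velocity, away from `0` and `1`, is small if it is short. -/
theorem localAction_le_of_slow (hab : a ≤ b) (hp : SmoothPiece a b w wt wx) (hB : Continuous B)
    (hD : Continuous D) (hsub : Icc a b ⊆ Icc 0 T) (G : Test12 T) {κ M χ₀ L : ℝ} (hχ₀ : 0 < χ₀)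
    (hκ : ∀ t ∈ Icc a b, ∀ θ, |wt t θ| ≤ κ)
    (hBw : ∀ t ∈ Icc a b, ∀ θ, B (w t θ) ∈ Icc κ M) (hDw : ∀ t ∈ Icc a b, ∀ θ, D (w t θ) ∈ Icc κ M)
    (hχw : ∀ t ∈ Icc a b, ∀ θ, χ₀ ≤ mobility (w t θ)) (hL : ∀ t ∈ Icc a b, ∀ θ, |wx t θ| ≤ L) :
    localAction B D G w a b ≤ (b - a) * (L ^ 2 / (8 * χ₀) + 2 * M) := by
  rw [localAction_eq hab hp hB hD hsub G]
  have hc := continuousOn_actionGain hp hB hD hsub G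
  have hle : ∀ t ∈ Icc a b, ∫ θ, actionGain B D G w wt wx t θ ≤ L ^ 2 / (8 * χ₀) + 2 * M := by
    intro t ht
    rw [← integral_torus_const (L ^ 2 / (8 * χ₀) + 2 * M)]
    refine integral_mono (integrable_of_continuous (continuousOn_slice hc ht))
      (integrable_const _) fun θ => ?_
    have h1 := hκ t ht θ
    have h2 := hBw t ht θ
    have h3 := hDw t ht θ
    have h4 := hχw t ht θ
    have h5 := hL t ht θ
    simp only [actionGain]
    set g := G.val t θ
    set p := G.dx t θ
    set v := wx t θ
    have hκ0 : 0 ≤ κ := (abs_nonneg _).trans h1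
    -- The reactions pay for the motion: `wt g ≤ κ e^{|g|} ≤ κ (e^g + e^{-g})`, which is at most `B
    -- e^g + D e^{-g}`. The constants left over from `e^{±g} - 1` sum to `B + D ≤ 2M`.
    have e1 : wt t θ * g ≤ κ * Real.exp |g| := by
      calc wt t θ * g ≤ |wt t θ| * |g| := by rw [← abs_mul]; exact le_abs_self _
        _ ≤ κ * Real.exp |g| := by
          gcongr
          linarith [Real.add_one_le_exp |g|]
    have e2 : Real.exp |g| ≤ Real.exp g + Real.exp (-g) := by
      rcases abs_cases g with ⟨h, _⟩ | ⟨h, _⟩ <;> rw [h] <;>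
        linarith [Real.exp_pos g, Real.exp_pos (-g)]
    have e3 : κ * Real.exp g ≤ B (w t θ) * Real.exp g := by gcongr; exact h2.1
    have e4 : κ * Real.exp (-g) ≤ D (w t θ) * Real.exp (-g) := by gcongr; exact h3.1
    have e5 : κ * Real.exp |g| ≤ κ * (Real.exp g + Real.exp (-g)) := by gcongr
    -- Maximum over `p` of a concave quadratic, with the mobility replaced by its lower bound.
    have e6 : 1 / 2 * (v * p) - 1 / 2 * (mobility (w t θ) * p ^ 2) ≤ L ^ 2 / (8 * χ₀) := by
      have : v ^ 2 ≤ L ^ 2 := sq_le_sq' (by linarith [neg_abs_le v]) ((le_abs_self v).trans h5)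
      rw [le_div_iff₀ (by positivity)]
      nlinarith [sq_nonneg (v - 2 * χ₀ * p), mul_le_mul_of_nonneg_right h4 (sq_nonneg p),
        mul_nonneg hχ₀.le (mul_nonneg (sub_nonneg.2 h4) (sq_nonneg p))]
    nlinarith [h2.2, h3.2]
  calc _ ≤ ∫ _ in a..b, (L ^ 2 / (8 * χ₀) + 2 * M) :=
        intervalIntegral.integral_mono_on hab
          ((continuousOn_integral_torus hc).intervalIntegrable_of_Icc hab)
          intervalIntegrable_const hle
    _ = _ := by rw [intervalIntegral.integral_const, smul_eq_mul]

/-- The entropy of a density profile. -/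
def entropy (g : UnitAddCircle → ℝ) : ℝ := ∫ θ, Real.binEntropy (g θ)

theorem mobility_pos {r : ℝ} (hr : r ∈ Ioo (0 : ℝ) 1) : 0 < mobility r :=
  mul_pos hr.1 (by linarith [hr.2])

theorem continuousOn_sq_div_mobility (hp : SmoothPiece a b w wt wx) :
    ContinuousOn (Function.uncurry fun t θ => wx t θ ^ 2 / (2 * mobility (w t θ)))
      (Icc a b ×ˢ univ) :=
  (hp.cont_x.pow 2).div ((uncurry_comp_continuousOn continuous_mobility hp.cont).const_mul 2)
    fun p h => (mul_pos two_pos (mobility_pos (hp.mem p.1 h.1 p.2))).ne'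

/-- Along the backward heat flow, the dissipation is the decrease of the entropy. -/
theorem integral_dissipation_eq (hab : a ≤ b) (hp : SmoothPiece a b w wt wx)
    {wxx : ℝ → UnitAddCircle → ℝ}
    (hxx : ∀ t ∈ Icc a b, ∀ x : ℝ, HasDerivAt (fun y : ℝ => wx t y) (wxx t x) x)
    (hcxx : ContinuousOn (Function.uncurry wxx) (Icc a b ×ˢ univ))
    (hheat : ∀ t ∈ Icc a b, ∀ θ, wt t θ = -(1 / 2 * wxx t θ)) :
    ∫ t in a..b, ∫ θ, wx t θ ^ 2 / (2 * mobility (w t θ)) = entropy (w a) - entropy (w b) := by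
  have hne0 : ∀ p ∈ Icc a b ×ˢ (univ : Set UnitAddCircle), Function.uncurry w p ≠ 0 :=
    fun p h => (hp.mem p.1 h.1 p.2).1.ne'
  have hne1 : ∀ p ∈ Icc a b ×ˢ (univ : Set UnitAddCircle), 1 - Function.uncurry w p ≠ 0 :=
    fun p h => (sub_pos.2 (hp.mem p.1 h.1 p.2).2).ne'
  have hlog : ContinuousOn (Function.uncurry fun t θ => Real.log (1 - w t θ) - Real.log (w t θ))
      (Icc a b ×ˢ univ) :=
    ((continuousOn_const.sub hp.cont).log hne1).sub (hp.cont.log hne0)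
  have hftc := integral_sub_eq_integral_deriv hab (φ := fun t θ => Real.binEntropy (w t θ))
    (φt := fun t θ => (Real.log (1 - w t θ) - Real.log (w t θ)) * wt t θ)
    (fun t ht θ => (Real.hasDerivAt_binEntropy (hp.mem t ht θ).1.ne'
      (hp.mem t ht θ).2.ne).comp_hasDerivWithinAt (h := fun s => w s θ) t (hp.hasDeriv_t t ht θ))
    (uncurry_comp_continuousOn Real.binEntropy_continuous hp.cont) (hlog.mul hp.cont_t)
  have hneg : entropy (w a) - entropy (w b)
      = -∫ t in a..b, ∫ θ, (Real.log (1 - w t θ) - Real.log (w t θ)) * wt t θ := by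
    rw [← hftc, entropy, entropy]; ring
  rw [hneg, ← intervalIntegral.integral_neg]
  refine intervalIntegral.integral_congr fun t ht => ?_
  rw [uIcc_of_le hab] at ht
  have hw := continuousOn_slice hp.cont ht
  have hwx := continuousOn_slice hp.cont_x ht
  have hm : ∀ θ, w t θ * (1 - w t θ) ≠ 0 := fun θ => (mobility_pos (hp.mem t ht θ)).ne'
  -- The derivative of the entropy is `log((1 - w)/w)`, whose space derivative is `-∇w / χ(w)`;
  -- integrating against `Δw` by parts yields the dissipation.
  have hibp := integral_mul_deriv_torus (g := fun θ => Real.log (1 - w t θ) - Real.log (w t θ))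
    (g' := fun θ => -(wx t θ / (w t θ * (1 - w t θ)))) (k := wx t) (k' := wxx t) (fun x => by
      have h0 := (hp.mem t ht x).1
      have h1 := sub_pos.2 (hp.mem t ht x).2
      have hd := hp.hasDeriv_x t ht x
      refine (((hd.const_sub 1).log h1.ne').sub (hd.log h0.ne')).congr_deriv ?_
      field_simp
      ring) (hwx.div (by fun_prop) hm).neg (hxx t ht) (continuousOn_slice hcxx ht)
  have e1 : ∫ θ, (Real.log (1 - w t θ) - Real.log (w t θ)) * wt t θ
      = -(1 / 2 * ∫ θ, (Real.log (1 - w t θ) - Real.log (w t θ)) * wxx t θ) := by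
    rw [← integral_const_mul, ← integral_neg]
    congr 1; funext θ; rw [hheat t ht θ]; ring
  rw [e1, hibp, ← integral_neg, neg_neg, ← integral_const_mul]
  congr 1; funext θ
  unfold mobility
  have := hm θ
  field_simp

/-- The action of a piece of the backward heat flow is controlled by the entropy. -/
theorem localAction_le_of_backward_heat (hab : a ≤ b) (hp : SmoothPiece a b w wt wx)
    (hB : Continuous B) (hD : Continuous D) (hsub : Icc a b ⊆ Icc 0 T) (G : Test12 T)
    {wxx : ℝ → UnitAddCircle → ℝ}
    (hxx : ∀ t ∈ Icc a b, ∀ x : ℝ, HasDerivAt (fun y : ℝ => wx t y) (wxx t x) x)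
    (hcxx : ContinuousOn (Function.uncurry wxx) (Icc a b ×ˢ univ))
    (hheat : ∀ t ∈ Icc a b, ∀ θ, wt t θ = -(1 / 2 * wxx t θ)) {M : ℝ}
    (hBw : ∀ t ∈ Icc a b, ∀ θ, B (w t θ) ∈ Icc 0 M)
    (hDw : ∀ t ∈ Icc a b, ∀ θ, D (w t θ) ∈ Icc 0 M) :
    localAction B D G w a b ≤ entropy (w a) - entropy (w b) + (b - a) * (2 * M) := by
  rw [localAction_eq hab hp hB hD hsub G]
  have hc := continuousOn_actionGain hp hB hD hsub G
  have hq := continuousOn_sq_div_mobility hp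
  have hle : ∀ t ∈ Icc a b, ∫ θ, actionGain B D G w wt wx t θ
      ≤ (∫ θ, wx t θ ^ 2 / (2 * mobility (w t θ))) + 2 * M := by
    intro t ht
    have hv := continuousOn_slice G.cont_val (hsub ht)
    have hx := continuousOn_slice G.cont_dx (hsub ht)
    have hwt := continuousOn_slice hp.cont_t ht
    have hwx := continuousOn_slice hp.cont_x ht
    -- With the backward sign the time derivative doubles the gradient term instead of cancelling
    -- it. The coefficient of `∇w ∇G` becomes `1`, and completing the square gives `(∇w)² / (2χ)`.
    have hibp : ∫ θ, wt t θ * G.val t θ = ∫ θ, 1 / 2 * (wx t θ * G.dx t θ) := by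
      have h := integral_mul_deriv_torus (hxx t ht) (continuousOn_slice hcxx ht)
        (G.hasDeriv_dx t (hsub ht)) hx
      rw [integral_const_mul, h, ← integral_neg, ← integral_const_mul]
      congr 1; funext θ; rw [hheat t ht θ]; ring
    have e1 : ∫ θ, actionGain B D G w wt wx t θ
        = ∫ θ, (actionGain B D G w wt wx t θ - wt t θ * G.val t θ
          + 1 / 2 * (wx t θ * G.dx t θ)) := by
      have hg := continuousOn_slice hc ht
      rw [integral_add (integrable_of_continuous (by fun_prop))
        (integrable_of_continuous (by fun_prop)), integral_sub (integrable_of_continuous (continuousOn_slice hc ht))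
        (integrable_of_continuous (by fun_prop)), hibp]
      ring
    have e2 : (∫ θ, wx t θ ^ 2 / (2 * mobility (w t θ))) + 2 * M
        = ∫ θ, (wx t θ ^ 2 / (2 * mobility (w t θ)) + 2 * M) := by
      rw [integral_add (integrable_of_continuous (continuousOn_slice hq ht)) (integrable_const _),
        integral_torus_const]
    rw [e1, e2]
    refine integral_mono (((integrable_of_continuous (continuousOn_slice hc ht)).sub
      (integrable_of_continuous (by fun_prop))).add (integrable_of_continuous (by fun_prop)))
      ((integrable_of_continuous (continuousOn_slice hq ht)).add (integrable_const _)) fun θ => ?_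
    have h2 := hBw t ht θ
    have h3 := hDw t ht θ
    have h4 := mobility_pos (hp.mem t ht θ)
    simp only [actionGain]
    set g := G.val t θ
    set p := G.dx t θ
    set v := wx t θ
    have e3 : 0 ≤ B (w t θ) * Real.exp g := mul_nonneg h2.1 (Real.exp_pos _).le
    have e4 : 0 ≤ D (w t θ) * Real.exp (-g) := mul_nonneg h3.1 (Real.exp_pos _).le
    have e6 : v * p - 1 / 2 * (mobility (w t θ) * p ^ 2) ≤ v ^ 2 / (2 * mobility (w t θ)) := by
      rw [le_div_iff₀ (by positivity)]
      nlinarith [sq_nonneg (v - mobility (w t θ) * p)]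
    nlinarith [h2.2, h3.2]
  rw [← integral_dissipation_eq hab hp hxx hcxx hheat]
  have hqi := (continuousOn_integral_torus hq).intervalIntegrable_of_Icc (μ := volume) hab
  calc _ ≤ ∫ t in a..b, ((∫ θ, wx t θ ^ 2 / (2 * mobility (w t θ))) + 2 * M) :=
        intervalIntegral.integral_mono_on hab
          ((continuousOn_integral_torus hc).intervalIntegrable_of_Icc hab)
          (hqi.add intervalIntegrable_const) hle
    _ = _ := by
        rw [intervalIntegral.integral_add hqi intervalIntegrable_const,
          intervalIntegral.integral_const, smul_eq_mul]

theorem continuousOn_energyDensity {S : Set ℝ} [LocallyCompactSpace S] (hS : S ⊆ Icc 0 T)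
    (G : Test01 T) (hw : ContinuousOn (Function.uncurry w) (S ×ˢ univ)) :
    ContinuousOn (energyDensity G w) S := by
  have hsub : S ×ˢ (univ : Set UnitAddCircle) ⊆ Icc 0 T ×ˢ univ := prod_mono hS subset_rfl
  refine (continuousOn_const.mul (continuousOn_integral_torus ?_)).sub
    (continuousOn_integral_torus ?_)
  · exact hw.mul (G.cont_dx.mono hsub)
  · exact (G.cont_val.mono hsub).pow 2

/-- By parts the integrand becomes `-2 (∇w) G - G²`, which is at most `(∇w)²`. -/
theorem integral_energyDensity_le (hab : a ≤ b) (hp : SmoothPiece a b w wt wx)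
    (hsub : Icc a b ⊆ Icc 0 T) (G : Test01 T) :
    ∫ t in a..b, energyDensity G w t ≤ ∫ t in a..b, ∫ θ, wx t θ ^ 2 := by
  have hsq : ContinuousOn (Function.uncurry fun t θ => wx t θ ^ 2) (Icc a b ×ˢ univ) :=
    hp.cont_x.pow 2
  refine intervalIntegral.integral_mono_on hab
    ((continuousOn_energyDensity hsub G hp.cont).intervalIntegrable_of_Icc hab)
    ((continuousOn_integral_torus hsq).intervalIntegrable_of_Icc hab) fun t ht => ?_
  have hv := continuousOn_slice G.cont_val (hsub ht)
  have hwx := continuousOn_slice hp.cont_x ht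
  have hibp := integral_mul_deriv_torus (hp.hasDeriv_x t ht) hwx
    (G.hasDeriv_dx t (hsub ht)) (continuousOn_slice G.cont_dx (hsub ht))
  rw [energyDensity, hibp, ← integral_neg, ← integral_const_mul,
    ← integral_sub (integrable_of_continuous (by fun_prop)) (integrable_of_continuous (by fun_prop))]
  refine integral_mono (integrable_of_continuous (by fun_prop))
    (integrable_of_continuous (by fun_prop)) fun θ => ?_
  simp only
  nlinarith [sq_nonneg (wx t θ + G.val t θ)]

theorem integral_sq_dx_le_of_bound (hab : a ≤ b) (hp : SmoothPiece a b w wt wx) {L : ℝ}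
    (hL : ∀ t ∈ Icc a b, ∀ θ, |wx t θ| ≤ L) :
    ∫ t in a..b, ∫ θ, wx t θ ^ 2 ≤ (b - a) * L ^ 2 := by
  have hsq : ContinuousOn (Function.uncurry fun t θ => wx t θ ^ 2) (Icc a b ×ˢ univ) :=
    hp.cont_x.pow 2
  calc _ ≤ ∫ _ in a..b, L ^ 2 := by
        refine intervalIntegral.integral_mono_on hab
          ((continuousOn_integral_torus hsq).intervalIntegrable_of_Icc hab)
          intervalIntegrable_const fun t ht => ?_
        rw [← integral_torus_const (L ^ 2)]
        refine integral_mono (integrable_of_continuous (continuousOn_slice hsq ht))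
          (integrable_const _) fun θ => ?_
        exact sq_le_sq' (by linarith [neg_abs_le (wx t θ), hL t ht θ])
          ((le_abs_self _).trans (hL t ht θ))
    _ = _ := by simp

/-- Since `2χ ≤ 1`, the entropy bound for the action also controls the energy of the backward flow.
-/
theorem integral_sq_dx_le_dissipation (hab : a ≤ b) (hp : SmoothPiece a b w wt wx) :
    ∫ t in a..b, ∫ θ, wx t θ ^ 2 ≤ ∫ t in a..b, ∫ θ, wx t θ ^ 2 / (2 * mobility (w t θ)) := by
  have hsq : ContinuousOn (Function.uncurry fun t θ => wx t θ ^ 2) (Icc a b ×ˢ univ) :=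
    hp.cont_x.pow 2
  have hq := continuousOn_sq_div_mobility hp
  refine intervalIntegral.integral_mono_on hab
    ((continuousOn_integral_torus hsq).intervalIntegrable_of_Icc hab)
    ((continuousOn_integral_torus hq).intervalIntegrable_of_Icc hab) fun t ht => ?_
  refine integral_mono (integrable_of_continuous (continuousOn_slice hsq ht))
    (integrable_of_continuous (continuousOn_slice hq ht)) fun θ => ?_
  have h4 := mobility_pos (hp.mem t ht θ)
  have h5 : 2 * mobility (w t θ) ≤ 1 := by
    unfold mobility; nlinarith [sq_nonneg (w t θ - 1 / 2)]
  exact le_div_self (sq_nonneg _) (by positivity) h5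

end piece

/-! ### Paths of density profiles -/

/-- A genuine function with values in `[0,1]` that represents some density. -/
def IsDensity (g : UnitAddCircle → ℝ) : Prop := Measurable g ∧ ∀ θ, g θ ∈ Icc (0 : ℝ) 1

theorem IsDensity.memLp {g : UnitAddCircle → ℝ} (h : IsDensity g) :
    MemLp g 2 (volume : Measure UnitAddCircle) :=
  MemLp.of_bound h.1.aestronglyMeasurable 1 (Eventually.of_forall (abs_le_one_of_mem_Icc h.2))

theorem IsDensity.integrable {g : UnitAddCircle → ℝ} (h : IsDensity g) : Integrable g :=
  integrable_of_measurable_bound h.1 (abs_le_one_of_mem_Icc h.2)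

theorem IsDensity.abs_sub_le {f g : UnitAddCircle → ℝ} (hf : IsDensity f) (hg : IsDensity g)
    (θ : UnitAddCircle) : |f θ - g θ| ≤ 1 :=
  abs_le.2 ⟨by linarith [(hf.2 θ).1, (hg.2 θ).2], by linarith [(hf.2 θ).2, (hg.2 θ).1]⟩

/-- The profile of a density. -/
def IsDensity.toProfile {g : UnitAddCircle → ℝ} (h : IsDensity g) : Profile :=
  ⟨h.memLp.toLp g, by
    filter_upwards [h.memLp.coeFn_toLp] with θ hθ
    rw [hθ]
    exact h.2 θ⟩

open Classical in
/-- The measure with density `g`; the zero measure if `g` is not a density. -/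
def measureOf (g : UnitAddCircle → ℝ) : SubMeasure :=
  if h : IsDensity g then h.toProfile.toMeasure else ⟨0, by simp⟩

/-! ### Measures with a given density and their weak convergence -/

section measureOf

variable {g : UnitAddCircle → ℝ}

theorem measureOf_eq (h : IsDensity g) : measureOf g = h.toProfile.toMeasure := dif_pos h

theorem toMeasure_eq_of_ae {p q : Profile} (h : (p.1 : UnitAddCircle → ℝ) =ᵐ[volume] q.1) :
    p.toMeasure = q.toMeasure := by
  have : p = q := Subtype.ext (Lp.ext h)
  rw [this]

theorem measureOf_eq_of_ae (h : IsDensity g) {p : Profile}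
    (hp : (p.1 : UnitAddCircle → ℝ) =ᵐ[volume] g) : measureOf g = p.toMeasure := by
  rw [measureOf_eq h]
  exact toMeasure_eq_of_ae (h.memLp.coeFn_toLp.trans hp.symm)

theorem meas_measureOf (h : IsDensity g) :
    (measureOf g).meas = volume.withDensity fun θ => ENNReal.ofReal (g θ) := by
  rw [measureOf_eq h]
  change volume.withDensity (fun θ => ENNReal.ofReal (h.toProfile.1 θ)) = _
  refine withDensity_congr_ae ?_
  filter_upwards [h.memLp.coeFn_toLp] with θ hθ
  change ENNReal.ofReal (h.memLp.toLp g θ) = _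
  rw [hθ]

theorem integral_measureOf (h : IsDensity g) (φ : UnitAddCircle → ℝ) :
    ∫ θ, φ θ ∂(measureOf g).meas = ∫ θ, φ θ * g θ := by
  rw [meas_measureOf h, integral_withDensity_eq_integral_toReal_smul
    h.1.ennreal_ofReal (Eventually.of_forall fun _ => ENNReal.ofReal_lt_top)]
  congr 1
  funext θ
  rw [ENNReal.toReal_ofReal (h.2 θ).1, smul_eq_mul, mul_comm]

theorem density_measureOf (h : IsDensity g) : density (measureOf g) =ᵐ[volume] g := by
  have h1 := Measure.rnDeriv_withDensity (volume : Measure UnitAddCircle) h.1.ennreal_ofReal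
  filter_upwards [h1] with θ hθ
  rw [density, meas_measureOf h, hθ, ENNReal.toReal_ofReal (h.2 θ).1]

theorem integral_density_measureOf (h : IsDensity g) (Ψ : ℝ → UnitAddCircle → ℝ) :
    ∫ θ, Ψ (density (measureOf g) θ) θ = ∫ θ, Ψ (g θ) θ := by
  refine integral_congr_ae ?_
  filter_upwards [density_measureOf h] with θ hθ
  rw [hθ]

theorem measureOf_mem_boundedDensity (h : IsDensity g) : measureOf g ∈ boundedDensity :=
  ⟨h.toProfile, (measureOf_eq h).symm⟩

theorem tendsto_measureOf {ι : Type*} {F : Filter ι} {u : ι → UnitAddCircle → ℝ}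
    (hu : ∀ᶠ i in F, IsDensity (u i)) (hg : IsDensity g)
    (h : ∀ φ : UnitAddCircle → ℝ, Continuous φ →
      Tendsto (fun i => ∫ θ, φ θ * u i θ) F (𝓝 (∫ θ, φ θ * g θ))) :
    Tendsto (fun i => measureOf (u i)) F (𝓝 (measureOf g)) := by
  rw [tendsto_subtype_rng, FiniteMeasure.tendsto_iff_forall_integral_tendsto]
  intro φ
  have h1 := h φ φ.continuous
  rw [← integral_measureOf hg] at h1
  refine h1.congr' ?_
  filter_upwards [hu] with i hi
  exact (integral_measureOf hi _).symm

end measureOf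

/-! ### Rate of a path that is continuous before its final time -/

section path

variable {T : ℝ} {w : ℝ → UnitAddCircle → ℝ}

theorem tendsto_integral_mul {t : ℝ}
    (hcont : ContinuousOn (Function.uncurry w) (Ico 0 T ×ˢ univ)) (ht : t ∈ Ico 0 T)
    {φ : UnitAddCircle → ℝ} (hφ : Continuous φ) :
    Tendsto (fun s => ∫ θ, φ θ * w s θ) (𝓝[Ico 0 T] t) (𝓝 (∫ θ, φ θ * w t θ)) :=
  continuousOn_integral_torus (φ := fun s θ => φ θ * w s θ)
    ((hφ.comp_continuousOn continuousOn_snd).mul hcont) t ht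

/-- The path is in fact weakly continuous: before `T` by joint continuity of the density, at `T` by
`hweak`. -/
theorem isCadlagOn_measureOf (hT : 0 < T) (hwm : ∀ t ∈ Icc 0 T, IsDensity (w t))
    (hcont : ContinuousOn (Function.uncurry w) (Ico 0 T ×ˢ univ))
    (hweak : ∀ φ : UnitAddCircle → ℝ, Continuous φ →
      Tendsto (fun t => ∫ θ, φ θ * w t θ) (𝓝[<] T) (𝓝 (∫ θ, φ θ * w T θ))) :
    IsCadlagOn T fun t => measureOf (w t) := by
  have hco : ∀ t ∈ Ico 0 T, Tendsto (fun s => measureOf (w s)) (𝓝[Ico 0 T] t)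
      (𝓝 (measureOf (w t))) := fun t ht =>
    tendsto_measureOf (by
      filter_upwards [self_mem_nhdsWithin] with s hs using hwm s (Ico_subset_Icc_self hs))
      (hwm t (Ico_subset_Icc_self ht)) fun φ hφ => tendsto_integral_mul hcont ht hφ
  constructor
  · intro t ht
    refine (hco t ht).mono_left ?_
    rw [← nhdsWithin_Ico_eq_nhdsGE ht.2]
    exact nhdsWithin_mono _ (Ico_subset_Ico_left ht.1)
  · intro t ht
    refine ⟨measureOf (w t), ?_⟩
    rcases ht.2.lt_or_eq with h | rfl
    · refine (hco t ⟨ht.1.le, h⟩).mono_left ?_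
      rw [← nhdsWithin_Ico_eq_nhdsLT ht.1]
      exact nhdsWithin_mono _ (Ico_subset_Ico_right h.le)
    · refine tendsto_measureOf ?_ (hwm t (right_mem_Icc.2 hT.le)) hweak
      filter_upwards [Ioo_mem_nhdsLT hT] with s hs using hwm s (Ioo_subset_Icc_self hs)

theorem exists_bound_of_continuousOn {φ : ℝ → UnitAddCircle → ℝ}
    (hφ : ContinuousOn (Function.uncurry φ) (Icc 0 T ×ˢ univ)) :
    ∃ C, 0 ≤ C ∧ ∀ t ∈ Icc 0 T, ∀ θ, |φ t θ| ≤ C := by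
  obtain ⟨C, hC⟩ := ((isCompact_Icc.prod isCompact_univ).image_of_continuousOn hφ.norm).bddAbove
  refine ⟨max C 0, le_max_right _ _, fun t ht θ => (hC ?_).trans (le_max_left _ _)⟩
  exact ⟨(t, θ), ⟨ht, mem_univ _⟩, rfl⟩

theorem abs_integral_torus_le {φ : UnitAddCircle → ℝ} {C : ℝ} (h : ∀ θ, |φ θ| ≤ C) :
    |∫ θ, φ θ| ≤ C := by
  have := norm_integral_le_of_norm_le_const (μ := (volume : Measure UnitAddCircle)) (f := φ)
    (Eventually.of_forall h)
  simpa [measureReal_def] using this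

/-- Integrals in space of continuous functions of a path are integrable in time. -/
theorem intervalIntegrable_comp_path (hT : 0 ≤ T) (hwm : ∀ t ∈ Icc 0 T, IsDensity (w t))
    (hcont : ContinuousOn (Function.uncurry w) (Ico 0 T ×ˢ univ)) {Ψ : ℝ → ℝ} (hΨ : Continuous Ψ)
    {φ : ℝ → UnitAddCircle → ℝ} (hφ : ContinuousOn (Function.uncurry φ) (Icc 0 T ×ˢ univ)) :
    IntervalIntegrable (fun t => ∫ θ, Ψ (w t θ) * φ t θ) volume 0 T := by
  obtain ⟨C, hC0, hC⟩ := exists_bound_of_continuousOn hφ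
  obtain ⟨K, hK⟩ := (isCompact_Icc (a := (0 : ℝ)) (b := 1)).image_of_continuousOn
    hΨ.norm.continuousOn |>.bddAbove
  refine intervalIntegrable_of_continuousOn_Ico (C := K * C) hT
    (continuousOn_integral_torus ((uncurry_comp_continuousOn hΨ hcont).mul
      (hφ.mono (prod_mono Ico_subset_Icc_self subset_rfl)))) fun t ht => ?_
  refine abs_integral_torus_le fun θ => ?_
  have ht' := Ico_subset_Icc_self ht
  have h1 : |Ψ (w t θ)| ≤ K := hK ⟨w t θ, (hwm t ht').2 θ, rfl⟩
  rw [abs_mul]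
  exact mul_le_mul h1 (hC t ht' θ) (abs_nonneg _) ((abs_nonneg _).trans h1)

/-- Weak convergence for a test function that also varies in time: freezing it at `T` costs at most
the L¹ distance between `v t` and `v T`, because `|w| ≤ 1`. -/
theorem tendsto_integral_val (hT : 0 < T) (hwm : ∀ t ∈ Icc 0 T, IsDensity (w t))
    (hweak : ∀ φ : UnitAddCircle → ℝ, Continuous φ →
      Tendsto (fun t => ∫ θ, φ θ * w t θ) (𝓝[<] T) (𝓝 (∫ θ, φ θ * w T θ)))
    {v : ℝ → UnitAddCircle → ℝ} (hv : ContinuousOn (Function.uncurry v) (Icc 0 T ×ˢ univ)) :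
    Tendsto (fun t => ∫ θ, v t θ * w t θ) (𝓝[<] T) (𝓝 (∫ θ, v T θ * w T θ)) := by
  have hTm : T ∈ Icc 0 T := right_mem_Icc.2 hT.le
  have hvT := continuousOn_slice hv hTm
  have h1 := hweak (v T) hvT
  have h2 : Tendsto (fun t => ∫ θ, |v t θ - v T θ|) (𝓝[<] T) (𝓝 0) := by
    have hc : ContinuousOn (fun t => ∫ θ, |v t θ - v T θ|) (Icc 0 T) :=
      continuousOn_integral_torus (φ := fun t θ => |v t θ - v T θ|)
        (hv.sub (hvT.comp_continuousOn continuousOn_snd)).abs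
    have := hc T hTm
    simp only [ContinuousWithinAt, sub_self, abs_zero, integral_zero] at this
    refine this.mono_left ?_
    rw [← nhdsWithin_Ioo_eq_nhdsLT hT]
    exact nhdsWithin_mono _ Ioo_subset_Icc_self
  have h3 : Tendsto (fun t => (∫ θ, v t θ * w t θ) - ∫ θ, v T θ * w t θ) (𝓝[<] T) (𝓝 0) := by
    refine squeeze_zero_norm' ?_ h2
    filter_upwards [Ioo_mem_nhdsLT hT] with t ht
    have ht' := Ioo_subset_Icc_self ht
    have hvt := continuousOn_slice hv ht'
    have hint : ∀ φ : UnitAddCircle → ℝ, Continuous φ → Integrable fun θ => φ θ * w t θ :=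
      fun φ hφ => (integrable_of_continuous hφ).mul_bdd (c := 1)
        (hwm t ht').1.aestronglyMeasurable
        (Eventually.of_forall (abs_le_one_of_mem_Icc (hwm t ht').2))
    rw [← integral_sub (hint _ hvt) (hint _ hvT)]
    refine (norm_integral_le_integral_norm _).trans (integral_mono_of_nonneg
      (Eventually.of_forall fun _ => norm_nonneg _) (integrable_of_continuous (by fun_prop))
      (Eventually.of_forall fun θ => ?_))
    simp only
    rw [← sub_mul, norm_mul]
    exact mul_le_of_le_one_right (norm_nonneg _) (abs_le_one_of_mem_Icc (hwm t ht').2 θ)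
  have := h3.add h1
  simpa using this

theorem tendsto_integral_nhdsLT (hT : 0 < T) {k : ℝ → ℝ} (hk : IntervalIntegrable k volume 0 T) :
    Tendsto (fun τ => ∫ t in (0 : ℝ)..τ, k t) (𝓝[<] T) (𝓝 (∫ t in (0 : ℝ)..T, k t)) := by
  have hk' := (intervalIntegrable_iff_integrableOn_Icc_of_le hT.le).1 hk
  rw [← uIcc_of_le hT.le] at hk'
  have hc := intervalIntegral.continuousOn_primitive_interval hk'
  rw [uIcc_of_le hT.le] at hc
  refine (hc T (right_mem_Icc.2 hT.le)).mono_left ?_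
  rw [← nhdsWithin_Ioo_eq_nhdsLT hT]
  exact nhdsWithin_mono _ Ioo_subset_Icc_self

theorem intervalIntegrable_actionDensity {B D : ℝ → ℝ} (hB : Continuous B) (hD : Continuous D)
    (hT : 0 ≤ T) (hwm : ∀ t ∈ Icc 0 T, IsDensity (w t))
    (hcont : ContinuousOn (Function.uncurry w) (Ico 0 T ×ˢ univ)) (G : Test12 T) :
    IntervalIntegrable (fun t => ∫ θ, (G.dt t θ + 1 / 2 * G.dxx t θ) * w t θ) volume 0 T ∧
    IntervalIntegrable (fun t => ∫ θ, mobility (w t θ) * G.dx t θ ^ 2) volume 0 T ∧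
    IntervalIntegrable (fun t => (∫ θ, B (w t θ) * (Real.exp (G.val t θ) - 1))
      + ∫ θ, D (w t θ) * (Real.exp (-G.val t θ) - 1)) volume 0 T := by
  refine ⟨?_, ?_, ?_⟩
  · simp_rw [mul_comm _ (w _ _)]
    exact intervalIntegrable_comp_path hT hwm hcont continuous_id
      (φ := fun t θ => G.dt t θ + 1 / 2 * G.dxx t θ) (G.cont_dt.add (G.cont_dxx.const_mul _))
  · exact intervalIntegrable_comp_path hT hwm hcont continuous_mobility
      (φ := fun t θ => G.dx t θ ^ 2) (G.cont_dx.pow 2)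
  · exact (intervalIntegrable_comp_path hT hwm hcont hB
      (φ := fun t θ => Real.exp (G.val t θ) - 1)
      ((Real.continuous_exp.comp_continuousOn G.cont_val).sub continuousOn_const)).add
      (intervalIntegrable_comp_path hT hwm hcont hD
      (φ := fun t θ => Real.exp (-G.val t θ) - 1)
      ((Real.continuous_exp.comp_continuousOn G.cont_val.neg).sub continuousOn_const))

theorem actionJ_measureOf {c : Config → ℝ} (hB : Continuous (birth c)) (hD : Continuous (death c))
    (hT : 0 < T) (hwm : ∀ t ∈ Icc 0 T, IsDensity (w t))
    (hcont : ContinuousOn (Function.uncurry w) (Ico 0 T ×ˢ univ)) (G : Test12 T) :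
    actionJ c T G (fun t => measureOf (w t)) = localAction (birth c) (death c) G w 0 T := by
  obtain ⟨i1, i2, i3⟩ := intervalIntegrable_actionDensity hB hD hT.le hwm hcont G
  have e1 : ∫ t in (0 : ℝ)..T, ∫ θ, (G.dt t θ + 1 / 2 * G.dxx t θ) ∂(measureOf (w t)).meas
      = ∫ t in (0 : ℝ)..T, ∫ θ, (G.dt t θ + 1 / 2 * G.dxx t θ) * w t θ :=
    intervalIntegral.integral_congr fun t ht => by
      rw [uIcc_of_le hT.le] at ht
      exact integral_measureOf (hwm t ht) _
  have e2 : ∫ t in (0 : ℝ)..T, ∫ θ, mobility (density (measureOf (w t)) θ) * G.dx t θ ^ 2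
      = ∫ t in (0 : ℝ)..T, ∫ θ, mobility (w t θ) * G.dx t θ ^ 2 :=
    intervalIntegral.integral_congr fun t ht => by
      rw [uIcc_of_le hT.le] at ht
      exact integral_density_measureOf (hwm t ht) fun r θ => mobility r * G.dx t θ ^ 2
  have e3 : ∫ t in (0 : ℝ)..T,
        ((∫ θ, birth c (density (measureOf (w t)) θ) * (Real.exp (G.val t θ) - 1))
          + ∫ θ, death c (density (measureOf (w t)) θ) * (Real.exp (-G.val t θ) - 1))
      = ∫ t in (0 : ℝ)..T, ((∫ θ, birth c (w t θ) * (Real.exp (G.val t θ) - 1))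
          + ∫ θ, death c (w t θ) * (Real.exp (-G.val t θ) - 1)) :=
    intervalIntegral.integral_congr fun t ht => by
      rw [uIcc_of_le hT.le] at ht
      exact congrArg₂ (· + ·)
        (integral_density_measureOf (hwm t ht) fun r θ => birth c r * (Real.exp (G.val t θ) - 1))
        (integral_density_measureOf (hwm t ht) fun r θ => death c r * (Real.exp (-G.val t θ) - 1))
  rw [actionJ, e1, e2, e3, integral_measureOf (hwm T (right_mem_Icc.2 hT.le)),
    integral_measureOf (hwm 0 (left_mem_Icc.2 hT.le)), localAction]
  unfold actionDensity
  rw [intervalIntegral.integral_add (i1.add (i2.const_mul _)) i3,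
    intervalIntegral.integral_add i1 (i2.const_mul _), intervalIntegral.integral_const_mul]
  ring

/-- The rate of a path is controlled by its action and its energy before the final time. -/
theorem rate_measureOf_le {c : Config → ℝ} (hB : Continuous (birth c))
    (hD : Continuous (death c)) (hT : 0 < T) (hwm : ∀ t ∈ Icc 0 T, IsDensity (w t))
    (hcont : ContinuousOn (Function.uncurry w) (Ico 0 T ×ˢ univ))
    (hweak : ∀ φ : UnitAddCircle → ℝ, Continuous φ →
      Tendsto (fun t => ∫ θ, φ θ * w t θ) (𝓝[<] T) (𝓝 (∫ θ, φ θ * w T θ))) {A E : ℝ}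
    (hA : ∀ G : Test12 T, ∀ᶠ τ in 𝓝[<] T, localAction (birth c) (death c) G w 0 τ ≤ A)
    (hE : ∀ G : Test01 T, ∀ᶠ τ in 𝓝[<] T, ∫ t in (0 : ℝ)..τ, energyDensity G w t ≤ E) :
    rate c T (fun t => measureOf (w t)) ≤ ENNReal.ofReal A := by
  have hAT : ∀ G : Test12 T, actionJ c T G (fun t => measureOf (w t)) ≤ A := fun G => by
    rw [actionJ_measureOf hB hD hT hwm hcont G]
    obtain ⟨i1, i2, i3⟩ := intervalIntegrable_actionDensity hB hD hT.le hwm hcont G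
    -- The bounds are only assumed before `T`, where the path can be smooth; all three terms of the
    -- action pass to the left limit.
    exact le_of_tendsto (((tendsto_integral_val hT hwm hweak G.cont_val).sub
      tendsto_const_nhds).sub (tendsto_integral_nhdsLT hT ((i1.add (i2.const_mul _)).add i3)))
      (hA G)
  have hET : energy T (fun t => measureOf (w t)) ≤ (E : EReal) := by
    refine iSup_le fun G => EReal.coe_le_coe_iff.2 ?_
    have i1 : IntervalIntegrable (fun t => ∫ θ, w t θ * G.dx t θ) volume 0 T :=
      intervalIntegrable_comp_path hT.le hwm hcont continuous_id G.cont_dx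
    have hsq : ContinuousOn (Function.uncurry fun t θ => G.val t θ ^ 2) (Icc 0 T ×ˢ univ) :=
      G.cont_val.pow 2
    have i2 : IntervalIntegrable (fun t => ∫ θ, G.val t θ ^ 2) volume 0 T :=
      (continuousOn_integral_torus hsq).intervalIntegrable_of_Icc hT.le
    have e1 : ∫ t in (0 : ℝ)..T, ∫ θ, density (measureOf (w t)) θ * G.dx t θ
        = ∫ t in (0 : ℝ)..T, ∫ θ, w t θ * G.dx t θ :=
      intervalIntegral.integral_congr fun t ht => by
        rw [uIcc_of_le hT.le] at ht
        exact integral_density_measureOf (hwm t ht) fun r θ => r * G.dx t θ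
    rw [e1, ← intervalIntegral.integral_const_mul, ← intervalIntegral.integral_sub
      (i1.const_mul 2) i2]
    exact le_of_tendsto (tendsto_integral_nhdsLT hT ((i1.const_mul 2).sub i2)) (hE G)
  rw [rate, if_pos ⟨fun t ht => measureOf_mem_boundedDensity (hwm t ht),
    hET.trans_lt (EReal.coe_lt_top E)⟩]
  calc _ ≤ EReal.toENNReal (A : EReal) :=
        EReal.toENNReal_le_toENNReal (iSup_le fun G => EReal.coe_le_coe_iff.2 (hAT G))
    _ = ENNReal.ofReal A := EReal.toENNReal_of_ne_top (EReal.coe_ne_top A)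

end path

/-! ### The two pieces of a cheap path -/

theorem SmoothPiece.congr {a b : ℝ} {w w' wt wx : ℝ → UnitAddCircle → ℝ}
    (hp : SmoothPiece a b w wt wx) (h : ∀ t ∈ Icc a b, w' t = w t) : SmoothPiece a b w' wt wx where
  hasDeriv_t t ht θ := (hp.hasDeriv_t t ht θ).congr (fun s hs => by rw [h s hs]) (by rw [h t ht])
  hasDeriv_x t ht x := by rw [h t ht]; exact hp.hasDeriv_x t ht x
  cont := hp.cont.congr fun p hp' => by simp only [Function.uncurry, h p.1 hp'.1]
  cont_t := hp.cont_t
  cont_x := hp.cont_x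
  mem t ht θ := by rw [h t ht]; exact hp.mem t ht θ

theorem smoothPiece_heat {f : UnitAddCircle → ℝ} (hf : Measurable f) (hb : ∀ θ, |f θ| ≤ 1)
    {a b T : ℝ} (hbT : b < T) (hmem : ∀ s, 0 < s → ∀ θ, heat s f θ ∈ Ioo (0 : ℝ) 1) :
    SmoothPiece a b (fun t => heat (T - t) f) (fun t θ => -(1 / 2 * heatDxx (T - t) f θ))
      (fun t => heatDx (T - t) f) := by
  have hpos : ∀ t ∈ Icc a b, 0 < T - t := fun t ht => by linarith [ht.2]
  have hc : ContinuousOn (fun p : ℝ × UnitAddCircle => (T - p.1, p.2)) (Icc a b ×ˢ univ) := by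
    fun_prop
  have hm : MapsTo (fun p : ℝ × UnitAddCircle => (T - p.1, p.2)) (Icc a b ×ˢ univ)
      (Ioi 0 ×ˢ univ) := fun p hp => ⟨hpos p.1 hp.1, mem_univ _⟩
  refine ⟨fun t ht θ => ?_, fun t ht x => hasDerivAt_heat hf hb (hpos t ht) x,
    (continuousOn_heat hf hb).comp hc hm,
    ((continuousOn_heatDxx hf hb).comp hc hm).const_mul (1 / 2) |>.neg,
    (continuousOn_heatDx hf hb).comp hc hm, fun t ht θ => hmem _ (hpos t ht) θ⟩
  have h := (hasDerivAt_heat_time hf hb (hpos t ht) θ).comp t ((hasDerivAt_id t).const_sub T)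
  refine HasDerivAt.hasDerivWithinAt ?_
  simpa [Function.comp_def] using h

theorem smoothPiece_linear {p p' q q' : UnitAddCircle → ℝ} {τ : ℝ} (hτ : 0 < τ)
    (hp : ∀ x : ℝ, HasDerivAt (fun y : ℝ => p y) (p' x) x) (hp' : Continuous p')
    (hq : ∀ x : ℝ, HasDerivAt (fun y : ℝ => q y) (q' x) x) (hq' : Continuous q')
    (hpm : ∀ θ, p θ ∈ Ioo (0 : ℝ) 1) (hqm : ∀ θ, q θ ∈ Ioo (0 : ℝ) 1) :
    SmoothPiece 0 τ (fun t θ => p θ + t / τ * (q θ - p θ)) (fun _ θ => (q θ - p θ) / τ)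
      (fun t θ => p' θ + t / τ * (q' θ - p' θ)) := by
  have hpc := continuous_of_hasDerivAt hp
  have hqc := continuous_of_hasDerivAt hq
  refine ⟨fun t _ θ => ?_, fun t _ x => (hp x).add (((hq x).sub (hp x)).const_mul _),
    ?_, ?_, ?_, fun t ht θ => ?_⟩
  · have h := (((hasDerivAt_id t).div_const τ).mul_const (q θ - p θ)).const_add (p θ)
    refine (h.congr_deriv ?_).hasDerivWithinAt
    ring
  · exact Continuous.continuousOn (by unfold Function.uncurry; fun_prop)
  · exact Continuous.continuousOn (by unfold Function.uncurry; fun_prop)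
  · exact Continuous.continuousOn (by unfold Function.uncurry; fun_prop)
  · have hs0 : 0 ≤ t / τ := div_nonneg ht.1 hτ.le
    have hs1 : t / τ ≤ 1 := (div_le_one hτ).2 ht.2
    have := (convex_Ioo (0 : ℝ) 1).add_smul_sub_mem (hpm θ) (hqm θ) ⟨hs0, hs1⟩
    simpa using this

/-- The path that interpolates linearly between `p` and `heat δ f` on `[0,τ]` and then follows
the backward heat flow up to `f` on `[τ, τ + δ]`. -/
def cheapPath (p f : UnitAddCircle → ℝ) (τ δ t : ℝ) (θ : UnitAddCircle) : ℝ :=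
  (p θ + min t τ / τ * (heat δ f θ - p θ)) + heat (τ + δ - max t τ) f θ - heat δ f θ

/-! ### Regularity and cost of the two-piece path -/

section cheapPath

variable {p f : UnitAddCircle → ℝ} {τ δ : ℝ}

theorem cheapPath_of_le {t : ℝ} (ht : t ≤ τ) :
    cheapPath p f τ δ t = fun θ => p θ + t / τ * (heat δ f θ - p θ) := by
  funext θ
  simp [cheapPath, ht]

theorem cheapPath_of_ge (hτ : 0 < τ) {t : ℝ} (ht : τ ≤ t) :
    cheapPath p f τ δ t = heat (τ + δ - t) f := by
  funext θ
  simp [cheapPath, ht, hτ.ne']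

theorem cheapPath_zero (hτ : 0 < τ) : cheapPath p f τ δ 0 = p := by
  rw [cheapPath_of_le hτ.le]; simp

theorem cheapPath_end (hτ : 0 < τ) (hδ : 0 < δ) : cheapPath p f τ δ (τ + δ) = f := by
  rw [cheapPath_of_ge hτ (by linarith), sub_self, heat_zero]

theorem isDensity_heat (hf : IsDensity f) (s : ℝ) : IsDensity (heat s f) :=
  ⟨measurable_heat hf.1 s, heat_mem_Icc hf.1 hf.2 s⟩

theorem isDensity_cheapPath (hτ : 0 < τ) (hp : IsDensity p) (hf : IsDensity f) {t : ℝ}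
    (ht : 0 ≤ t) : IsDensity (cheapPath p f τ δ t) := by
  rcases le_total t τ with h | h
  · rw [cheapPath_of_le h]
    refine ⟨hp.1.add (((measurable_heat hf.1 δ).sub hp.1).const_mul _), fun θ => ?_⟩
    have := (convex_Icc (0 : ℝ) 1).add_smul_sub_mem (hp.2 θ) (heat_mem_Icc hf.1 hf.2 δ θ)
      ⟨div_nonneg ht hτ.le, (div_le_one hτ).2 h⟩
    simpa using this
  · rw [cheapPath_of_ge hτ h]
    exact isDensity_heat hf _

/-- No gluing at `τ` is needed: with the clamped times `min t τ` and `max t τ` the path is a single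
formula, and the heat time `τ + δ - max t τ` stays positive before the end. -/
theorem continuousOn_cheapPath (hδ : 0 < δ) (hp : Continuous p) (hf : IsDensity f) :
    ContinuousOn (Function.uncurry (cheapPath p f τ δ)) (Ico 0 (τ + δ) ×ˢ univ) := by
  have hb := abs_le_one_of_mem_Icc hf.2
  have hc := continuous_of_hasDerivAt (hasDerivAt_heat hf.1 hb hδ)
  have h2 : ContinuousOn (fun x : ℝ × UnitAddCircle => heat (τ + δ - max x.1 τ) f x.2)
      (Ico 0 (τ + δ) ×ˢ univ) :=
    (continuousOn_heat hf.1 hb).comp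
      (f := fun x : ℝ × UnitAddCircle => (τ + δ - max x.1 τ, x.2)) (by fun_prop) fun x hx =>
        ⟨sub_pos.2 (max_lt hx.1.2 (by linarith)), mem_univ _⟩
  have h1 : ContinuousOn (fun x : ℝ × UnitAddCircle =>
      p x.2 + min x.1 τ / τ * (heat δ f x.2 - p x.2)) (Ico 0 (τ + δ) ×ˢ univ) :=
    Continuous.continuousOn (by fun_prop)
  exact (h1.add h2).sub (hc.comp_continuousOn continuousOn_snd)

/-- As `f` need not be continuous, the end point is approached in the weak sense, by the weak
continuity of the heat semigroup at time zero. -/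
theorem tendsto_cheapPath (hτ : 0 < τ) (hδ : 0 < δ) (hf : IsDensity f)
    (φ : UnitAddCircle → ℝ) (hφ : Continuous φ) :
    Tendsto (fun t => ∫ θ, φ θ * cheapPath p f τ δ t θ) (𝓝[<] (τ + δ))
      (𝓝 (∫ θ, φ θ * cheapPath p f τ δ (τ + δ) θ)) := by
  rw [cheapPath_end hτ hδ, Metric.tendsto_nhds]
  intro ε hε
  obtain ⟨C, hC, hmod⟩ := exists_modulus hφ (half_pos hε)
  have hlim : Tendsto (fun t => ε / 2 + C * (τ + δ - t)) (𝓝[<] (τ + δ)) (𝓝 (ε / 2)) := by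
    have : Continuous fun t => ε / 2 + C * (τ + δ - t) := by fun_prop
    simpa using (this.tendsto (τ + δ)).mono_left nhdsWithin_le_nhds
  filter_upwards [hlim.eventually (gt_mem_nhds (half_lt_self hε)),
    Ioo_mem_nhdsLT (show τ < τ + δ by linarith)] with t ht1 ht2
  rw [cheapPath_of_ge hτ ht2.1.le, Real.dist_eq]
  exact (abs_integral_mul_heat_sub_le hf.1 (abs_le_one_of_mem_Icc hf.2) hφ hC hmod
    (by linarith [ht2.2])).trans_lt ht1

/-- The cost of the path, in terms of bounds on the two pieces. -/
theorem rate_cheapPath_le {c : Config → ℝ} {m M : ℝ} (hR : RateBounds (birth c) (death c) m M)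
    (hτ : 0 < τ) (hδ : 0 < δ) {p' : UnitAddCircle → ℝ} (hpd : IsDensity p)
    (hp : ∀ x : ℝ, HasDerivAt (fun y : ℝ => p y) (p' x) x) (hp' : Continuous p')
    (hf : IsDensity f) {e L κ S : ℝ} (he : 0 < e) (hκ : κ ≤ m * e)
    (hpe : ∀ θ, p θ ∈ Icc e (1 - e)) (hqe : ∀ θ, heat δ f θ ∈ Icc e (1 - e))
    (hpL : ∀ θ, |p' θ| ≤ L) (hqL : ∀ θ, |heatDx δ f θ| ≤ L)
    (hpq : ∀ θ, |heat δ f θ - p θ| ≤ κ * τ)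
    (hS : ∀ s, 0 < s → s ≤ δ → entropy (heat δ f) - entropy (heat s f) ≤ S) :
    IsCadlagOn (τ + δ) (fun t => measureOf (cheapPath p f τ δ t)) ∧
    rate c (τ + δ) (fun t => measureOf (cheapPath p f τ δ t))
      ≤ ENNReal.ofReal (τ * (L ^ 2 / (8 * e ^ 2) + 2 * M) + (S + δ * (2 * M))) := by
  have hT : 0 < τ + δ := by linarith
  have hfb := abs_le_one_of_mem_Icc hf.2
  have hwm : ∀ t ∈ Icc 0 (τ + δ), IsDensity (cheapPath p f τ δ t) := fun t ht =>
    isDensity_cheapPath hτ hpd hf ht.1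
  have hcont := continuousOn_cheapPath (τ := τ) hδ (continuous_of_hasDerivAt hp) hf
  have hweak := tendsto_cheapPath (p := p) hτ hδ hf
  refine ⟨isCadlagOn_measureOf hT hwm hcont hweak, ?_⟩
  -- Strict bounds at time `δ` propagate to every positive time, by the strong maximum principle for
  -- `f` and for `1 - f`.
  have hmem : ∀ s, 0 < s → ∀ θ, heat s f θ ∈ Ioo (0 : ℝ) 1 := fun s hs θ => by
    refine ⟨heat_pos_of_pos hf.1 hfb (fun θ => (hf.2 θ).1) hδ hs (he.trans_le (hqe 0).1), ?_⟩
    have h1 : ∀ θ, 1 - f θ ∈ Icc (0 : ℝ) 1 := fun θ =>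
      ⟨by linarith [(hf.2 θ).2], by linarith [(hf.2 θ).1]⟩
    have := heat_pos_of_pos (f := fun θ => 1 - f θ) (hf.1.const_sub 1) (abs_le_one_of_mem_Icc h1)
      (fun θ => (h1 θ).1) hδ hs (θ := 0) (θ' := θ) (by
        rw [heat_const_sub hf.1 hfb]; linarith [(hqe 0).2])
    rw [heat_const_sub hf.1 hfb] at this
    linarith
  have hIoo : ∀ {g : UnitAddCircle → ℝ}, (∀ θ, g θ ∈ Icc e (1 - e)) → ∀ θ, g θ ∈ Ioo (0 : ℝ) 1 :=
    fun h θ => ⟨he.trans_le (h θ).1, by linarith [(h θ).2]⟩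
  have hqc : Continuous (heatDx δ f) := continuous_of_hasDerivAt (hasDerivAt_heatDx hf.1 hfb hδ)
  have hsm1 := (smoothPiece_linear hτ hp hp' (hasDerivAt_heat hf.1 hfb hδ) hqc (hIoo hpe)
    (hIoo hqe)).congr (w' := cheapPath p f τ δ) fun t ht => cheapPath_of_le ht.2
  have hsm2 : ∀ σ ∈ Ioo τ (τ + δ), SmoothPiece τ σ (cheapPath p f τ δ)
      (fun t θ => -(1 / 2 * heatDxx (τ + δ - t) f θ)) (fun t => heatDx (τ + δ - t) f) := fun σ hσ =>
    (smoothPiece_heat hf.1 hfb hσ.2 hmem).congr fun t ht => cheapPath_of_ge hτ ht.1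
  have hxx : ∀ σ ∈ Ioo τ (τ + δ), ∀ t ∈ Icc τ σ, ∀ x : ℝ, HasDerivAt
      (fun y : ℝ => heatDx (τ + δ - t) f y) (heatDxx (τ + δ - t) f x) x := fun σ hσ t ht x =>
    hasDerivAt_heatDx hf.1 hfb (by linarith [hσ.2, ht.2]) x
  have hcxx : ∀ σ ∈ Ioo τ (τ + δ), ContinuousOn
      (Function.uncurry fun t θ => heatDxx (τ + δ - t) f θ) (Icc τ σ ×ˢ univ) := fun σ hσ =>
    (continuousOn_heatDxx hf.1 hfb).comp
      (f := fun x : ℝ × UnitAddCircle => (τ + δ - x.1, x.2)) (by fun_prop) fun x hx =>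
        ⟨sub_pos.2 (hx.1.2.trans_lt hσ.2), mem_univ _⟩
  have hent : ∀ σ ∈ Ioo τ (τ + δ),
      entropy (cheapPath p f τ δ τ) - entropy (cheapPath p f τ δ σ) ≤ S := fun σ hσ => by
    rw [cheapPath_of_ge hτ le_rfl, cheapPath_of_ge hτ hσ.1.le, add_sub_cancel_left]
    exact hS _ (by linarith [hσ.2]) (by linarith [hσ.1])
  have hLw : ∀ t ∈ Icc 0 τ, ∀ θ, |p' θ + t / τ * (heatDx δ f θ - p' θ)| ≤ L := fun t ht θ => by
    have := (convex_Icc (-L) L).add_smul_sub_mem (abs_le.1 (hpL θ)) (abs_le.1 (hqL θ))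
      ⟨div_nonneg ht.1 hτ.le, (div_le_one hτ).2 ht.2⟩
    exact abs_le.2 (by simpa using this)
  have hwe : ∀ t ∈ Icc 0 τ, ∀ θ, cheapPath p f τ δ t θ ∈ Icc e (1 - e) := fun t ht θ => by
    rw [cheapPath_of_le ht.2]
    have := (convex_Icc e (1 - e)).add_smul_sub_mem (hpe θ) (hqe θ)
      ⟨div_nonneg ht.1 hτ.le, (div_le_one hτ).2 ht.2⟩
    simpa using this
  have h0 : Icc 0 τ ⊆ Icc 0 (τ + δ) := Icc_subset_Icc_right (by linarith)
  have h1 : ∀ σ ∈ Ioo τ (τ + δ), Icc τ σ ⊆ Icc 0 (τ + δ) := fun σ hσ =>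
    Icc_subset_Icc hτ.le hσ.2.le
  have h0' : Icc 0 τ ⊆ Ico 0 (τ + δ) := fun t ht => ⟨ht.1, by linarith [ht.2]⟩
  have h1' : ∀ σ ∈ Ioo τ (τ + δ), Icc τ σ ⊆ Ico 0 (τ + δ) := fun σ hσ t ht =>
    ⟨hτ.le.trans ht.1, ht.2.trans_lt hσ.2⟩
  have hev : ∀ᶠ σ in 𝓝[<] (τ + δ), σ ∈ Ioo τ (τ + δ) := Ioo_mem_nhdsLT (by linarith)
  refine rate_measureOf_le hR.cont_B hR.cont_D hT hwm hcont hweak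
    (E := (τ - 0) * L ^ 2 + S) (fun G => ?_) fun G => ?_
  · filter_upwards [hev] with σ hσ
    have hk := continuousOn_actionDensity hR.cont_B hR.cont_D (T := τ + δ) Ico_subset_Icc_self G
      hcont
    have hadd : localAction (birth c) (death c) G (cheapPath p f τ δ) 0 σ
        = localAction (birth c) (death c) G (cheapPath p f τ δ) 0 τ
          + localAction (birth c) (death c) G (cheapPath p f τ δ) τ σ := by
      simp only [localAction]
      rw [← intervalIntegral.integral_add_adjacent_intervals
        ((hk.mono h0').intervalIntegrable_of_Icc hτ.le)
        ((hk.mono (h1' σ hσ)).intervalIntegrable_of_Icc hσ.1.le)]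
      ring
    -- On this piece `w` and `1 - w` are at least `e`, so `B ≥ m(1 - w) ≥ m e`, `D ≥ m w ≥ m e`, and
    -- the mobility is at least `e²`.
    have hb1 := localAction_le_of_slow hτ.le hsm1 hR.cont_B hR.cont_D h0 G (κ := m * e) (M := M)
      (χ₀ := e ^ 2) (L := L) (by positivity) (fun t _ θ => by
        rw [abs_div, abs_of_pos hτ, div_le_iff₀ hτ]
        exact (hpq θ).trans (by gcongr)) (fun t ht θ => by
        have hw := hwe t ht θ
        have hw' : cheapPath p f τ δ t θ ∈ Icc (0 : ℝ) 1 := (hwm t (h0 ht)).2 θ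
        constructor
        · nlinarith [hR.le_B _ hw', hR.m_pos, hw.2]
        · nlinarith [hR.B_le _ hw', hR.M_nonneg, hw'.1]) (fun t ht θ => by
        have hw := hwe t ht θ
        have hw' : cheapPath p f τ δ t θ ∈ Icc (0 : ℝ) 1 := (hwm t (h0 ht)).2 θ
        constructor
        · nlinarith [hR.le_D _ hw', hR.m_pos, hw.1]
        · nlinarith [hR.D_le _ hw', hR.M_nonneg, hw'.2]) (fun t ht θ => by
        have hw := hwe t ht θ
        unfold mobility
        nlinarith [hw.1, hw.2]) hLw
    have hb2 := localAction_le_of_backward_heat hσ.1.le (hsm2 σ hσ) hR.cont_B hR.cont_D (h1 σ hσ) G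
      (hxx σ hσ) (hcxx σ hσ) (fun t _ θ => rfl) (M := M) (fun t ht θ => by
        have hw' : cheapPath p f τ δ t θ ∈ Icc (0 : ℝ) 1 := (hwm t (h1 σ hσ ht)).2 θ
        constructor
        · nlinarith [hR.le_B _ hw', hR.m_pos, hw'.2]
        · nlinarith [hR.B_le _ hw', hR.M_nonneg, hw'.1]) (fun t ht θ => by
        have hw' : cheapPath p f τ δ t θ ∈ Icc (0 : ℝ) 1 := (hwm t (h1 σ hσ ht)).2 θ
        constructor
        · nlinarith [hR.le_D _ hw', hR.m_pos, hw'.1]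
        · nlinarith [hR.D_le _ hw', hR.M_nonneg, hw'.2])
    have hb3 : (σ - τ) * (2 * M) ≤ δ * (2 * M) :=
      mul_le_mul_of_nonneg_right (by linarith [hσ.2]) (by linarith [hR.M_nonneg])
    rw [sub_zero] at hb1
    linarith [hent σ hσ]
  · filter_upwards [hev] with σ hσ
    have hk := continuousOn_energyDensity (T := τ + δ) Ico_subset_Icc_self G hcont
    rw [← intervalIntegral.integral_add_adjacent_intervals
        ((hk.mono h0').intervalIntegrable_of_Icc hτ.le)
        ((hk.mono (h1' σ hσ)).intervalIntegrable_of_Icc hσ.1.le)]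
    have hb1 := (integral_energyDensity_le hτ.le hsm1 h0 G).trans
      (integral_sq_dx_le_of_bound hτ.le hsm1 hLw)
    have hb2 := ((integral_energyDensity_le hσ.1.le (hsm2 σ hσ) (h1 σ hσ) G).trans
      (integral_sq_dx_le_dissipation hσ.1.le (hsm2 σ hσ))).trans_eq
      (integral_dissipation_eq hσ.1.le (hsm2 σ hσ) (hxx σ hσ) (hcxx σ hσ) (fun t _ θ => rfl))
    linarith [hent σ hσ]

end cheapPath

/-! ### Choice of the parameters -/

/-- The derivative of the periodic lift is periodic, hence descends to the torus. -/
theorem C2Profile.exists_deriv (r : C2Profile) : ∃ p' : UnitAddCircle → ℝ, Continuous p' ∧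
    ∀ x : ℝ, HasDerivAt (fun y : ℝ => r.fn y) (p' x) x := by
  have hper : Function.Periodic (deriv fun y : ℝ => r.fn y) 1 := fun x => by
    rw [← deriv_comp_add_const]
    congr 1
    funext y
    rw [AddCircle.coe_add, show ((1 : ℝ) : UnitAddCircle) = 0 from AddCircle.coe_period (1 : ℝ),
      add_zero]
  refine ⟨hper.lift, continuous_of_lift ?_, fun x => ?_⟩
  · exact r.contDiff.continuous_deriv (by norm_num)
  · exact ((r.contDiff.differentiable (by norm_num)) x).hasDerivAt

theorem exists_abs_heat_le {s : ℝ} (hs : 0 < s) {η : ℝ} (hη : 0 < η) :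
    ∃ C, 0 ≤ C ∧ ∀ f : UnitAddCircle → ℝ, Measurable f → (∀ θ, |f θ| ≤ 1) →
      ∀ θ, |heat s f θ| ≤ η + C * ∫ θ, |f θ| := by
  have hN := heatNorm_pos hs
  obtain ⟨C, hC, h⟩ := exists_abs_heatMoment_le (k := 0) (by simp) hs (div_pos hη hN)
  refine ⟨heatNorm s * C, by positivity, fun f hf hb θ => ?_⟩
  rw [heat_eq_moment hs, abs_mul, abs_of_pos hN]
  calc _ ≤ heatNorm s * (η / heatNorm s + C * ∫ θ, |f θ|) := by gcongr; exact h f hf hb θ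
    _ = _ := by field_simp

theorem exists_abs_heatDx_le {s : ℝ} (hs : 0 < s) {η : ℝ} (hη : 0 < η) :
    ∃ C, 0 ≤ C ∧ ∀ f : UnitAddCircle → ℝ, Measurable f → (∀ θ, |f θ| ≤ 1) →
      ∀ θ, |heatDx s f θ| ≤ η + C * ∫ θ, |f θ| := by
  have hN := heatNorm_pos hs
  obtain ⟨C, hC, h⟩ := exists_abs_heatMoment_le (k := 1) (by simp) hs
    (div_pos (mul_pos hη hs) hN)
  refine ⟨heatNorm s * C / s, by positivity, fun f hf hb θ => ?_⟩
  rw [heatDx, abs_mul, abs_div, abs_of_pos hN, abs_of_pos hs]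
  calc _ ≤ heatNorm s * ((η * s / heatNorm s + C * ∫ θ, |f θ|) / s) := by
        gcongr; exact h f hf hb θ
    _ = _ := by field_simp

/-- The quadratic modulus of `binEntropy` on `[0,1]` is integrated; differences of densities are at
most `1`, so their squares are dominated by their absolute values. -/
theorem exists_abs_entropy_sub_le {η : ℝ} (hη : 0 < η) :
    ∃ C, 0 ≤ C ∧ ∀ f g : UnitAddCircle → ℝ, IsDensity f → IsDensity g →
      |entropy f - entropy g| ≤ η + C * ∫ θ, |f θ - g θ| := by
  obtain ⟨C, hC, h⟩ := exists_modulus (α := Icc (0 : ℝ) 1)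
    (g := fun x => Real.binEntropy x) (by fun_prop) hη
  refine ⟨C, hC, fun f g hf hg => ?_⟩
  have hi : ∀ {u : UnitAddCircle → ℝ}, IsDensity u → Integrable fun θ => Real.binEntropy (u θ) :=
    fun {u} hu => integrable_of_measurable_bound (C := Real.log 2)
      (Real.binEntropy_continuous.measurable.comp hu.1) fun θ => by
      rw [abs_of_nonneg (Real.binEntropy_nonneg (hu.2 θ).1 (hu.2 θ).2)]
      exact Real.binEntropy_le_log_two
  have hd : Integrable fun θ => |f θ - g θ| := (hf.integrable.sub hg.integrable).abs
  rw [entropy, entropy, ← integral_sub (hi hf) (hi hg), ← integral_const_mul,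
    ← integral_torus_const η, ← integral_add (integrable_const _) (hd.const_mul C),
    ← Real.norm_eq_abs]
  refine norm_integral_le_of_norm_le ((integrable_const _).add (hd.const_mul C))
    (Eventually.of_forall fun θ => ?_)
  have h1 := h ⟨f θ, hf.2 θ⟩ ⟨g θ, hg.2 θ⟩
  simp only [Subtype.dist_eq, Real.dist_eq] at h1
  refine h1.trans ?_
  gcongr
  exact pow_le_of_le_one (abs_nonneg _) (hf.abs_sub_le hg θ) two_ne_zero

/-- Densities that are `L¹`-close to a smooth profile with values in `(0,1)` can be reached from
it at a small cost. -/
theorem exists_cheap_path {c : Config → ℝ} {m M : ℝ} (hR : RateBounds (birth c) (death c) m M)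
    {r : C2Profile} (hr : ∀ θ, r.fn θ ∈ Ioo (0 : ℝ) 1) {ε : ℝ} (hε : 0 < ε) :
    ∃ d, 0 < d ∧ ∀ f, IsDensity f → ∫ θ, |f θ - r.fn θ| < d →
      ∃ T, 0 < T ∧ ∃ w : ℝ → UnitAddCircle → ℝ, w 0 = r.fn ∧ w T = f ∧
        IsCadlagOn T (fun t => measureOf (w t)) ∧
        rate c T (fun t => measureOf (w t)) ≤ ENNReal.ofReal ε := by
  set p := r.fn with hpdef
  obtain ⟨p', hp'c, hp'⟩ := r.exists_deriv
  have hpc : Continuous p := r.continuous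
  have hpd : IsDensity p := ⟨hpc.measurable, r.mem_Icc⟩
  have hpb := abs_le_one_of_mem_Icc hpd.2
  have hm := hR.m_pos
  have hM := hR.M_nonneg
  -- The margin is `2e` so that a uniform perturbation of size `e` still leaves a margin `e`.
  obtain ⟨e, he, hpe⟩ : ∃ e, 0 < e ∧ ∀ θ, p θ ∈ Icc (2 * e) (1 - 2 * e) := by
    obtain ⟨a, -, ha⟩ := isCompact_univ.exists_isMinOn univ_nonempty hpc.continuousOn
    obtain ⟨b, -, hb⟩ := isCompact_univ.exists_isMaxOn univ_nonempty hpc.continuousOn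
    refine ⟨min (p a) (1 - p b) / 2, half_pos (lt_min (hr a).1 (sub_pos.2 (hr b).2)), fun θ => ?_⟩
    have h1 : p a ≤ p θ := ha (mem_univ θ)
    have h2 : p θ ≤ p b := hb (mem_univ θ)
    constructor <;> linarith [min_le_left (p a) (1 - p b), min_le_right (p a) (1 - p b)]
  obtain ⟨L, hL⟩ := (isCompact_range hp'c.norm).bddAbove
  have hL' : ∀ θ, |p' θ| ≤ L := fun θ => hL ⟨θ, rfl⟩
  have hL0 : 0 ≤ L := (abs_nonneg _).trans (hL' 0)
  have hlip : ∀ x y : ℝ, |p x - p y| ≤ L * |x - y| := fun x y =>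
    convex_univ.norm_image_sub_le_of_norm_hasDerivWithin_le (f := fun y : ℝ => p y)
      (fun z _ => (hp' z).hasDerivWithinAt) (fun z _ => hL' z) (mem_univ y) (mem_univ x)
  set K := (L + 1) ^ 2 / (8 * e ^ 2) + 2 * M + 1 with hK
  have hK0 : 0 < K := by positivity
  -- The linear piece then costs at most `ε/4`.
  set τ := ε / (4 * K) with hτdef
  have hτ : 0 < τ := by positivity
  obtain ⟨CH, hCH, hent⟩ := exists_abs_entropy_sub_le (η := ε / 16) (by positivity)
  -- The error `2σ` must satisfy three demands: speed at most `m e` over the time `τ`, a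
  -- perturbation of at most `e`, and an entropy change of at most `ε/16 + ε/16`.
  obtain ⟨σ, hσ, hσ1, hσ2, hσ3⟩ : ∃ σ, 0 < σ ∧ σ ≤ m * e * τ / 2 ∧ σ ≤ e / 2 ∧
      CH * (2 * σ) ≤ ε / 16 := by
    refine ⟨min (min (m * e * τ / 2) (e / 2)) (ε / (32 * (CH + 1))), by positivity,
      (min_le_left _ _).trans (min_le_left _ _), (min_le_left _ _).trans (min_le_right _ _), ?_⟩
    have h1 : CH * (2 * min (min (m * e * τ / 2) (e / 2)) (ε / (32 * (CH + 1))))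
        ≤ CH * (2 * (ε / (32 * (CH + 1)))) := by gcongr; exact min_le_right _ _
    refine h1.trans ?_
    have h2 : CH * (2 * (ε / (32 * (CH + 1)))) = ε / 16 * (CH / (CH + 1)) := by field_simp; ring
    rw [h2]
    exact mul_le_of_le_one_right (by positivity) ((div_le_one (by positivity)).2 (by linarith))
  obtain ⟨C, hC, hmod⟩ := exists_modulus hpc (half_pos hσ)
  obtain ⟨δ, hδ, hδ1, hδ2⟩ : ∃ δ, 0 < δ ∧ C * δ ≤ σ / 2 ∧ δ * (2 * M) ≤ ε / 4 := by
    refine ⟨min (σ / 2 / (C + 1)) (ε / 8 / (M + 1)), by positivity, ?_, ?_⟩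
    · calc _ ≤ C * (σ / 2 / (C + 1)) := by gcongr; exact min_le_left _ _
        _ = σ / 2 * (C / (C + 1)) := by ring
        _ ≤ σ / 2 := mul_le_of_le_one_right (by positivity)
          ((div_le_one (by positivity)).2 (by linarith))
    · calc _ ≤ ε / 8 / (M + 1) * (2 * M) := by gcongr; exact min_le_right _ _
        _ = ε / 4 * (M / (M + 1)) := by ring
        _ ≤ ε / 4 := mul_le_of_le_one_right (by positivity)
          ((div_le_one (by positivity)).2 (by linarith))
  have hheatp : ∀ s, 0 < s → s ≤ δ → ∀ θ, |heat s p θ - p θ| ≤ σ := fun s hs hsδ θ => by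
    have h1 := abs_heat_sub_le hpd.1 hpb hC hmod hs.le θ
    have h2 : C * s ≤ C * δ := by gcongr
    linarith
  obtain ⟨Ca, hCa, ha⟩ := exists_abs_heat_le hδ (half_pos hσ)
  obtain ⟨Cb, hCb, hb⟩ := exists_abs_heatDx_le hδ (half_pos one_pos)
  -- `d` comes last, because the smoothing constants `Ca` and `Cb` depend on `δ`.
  obtain ⟨d, hd, hd1, hd2, hd3⟩ : ∃ d, 0 < d ∧ Ca * d ≤ σ / 2 ∧ Cb * d ≤ 1 / 2 ∧ d ≤ σ := by
    refine ⟨min (min (σ / 2 / (Ca + 1)) (1 / 2 / (Cb + 1))) σ, by positivity, ?_, ?_,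
      min_le_right _ _⟩
    · calc _ ≤ Ca * (σ / 2 / (Ca + 1)) := by
            gcongr; exact (min_le_left _ _).trans (min_le_left _ _)
        _ = σ / 2 * (Ca / (Ca + 1)) := by ring
        _ ≤ σ / 2 := mul_le_of_le_one_right (by positivity)
          ((div_le_one (by positivity)).2 (by linarith))
    · calc _ ≤ Cb * (1 / 2 / (Cb + 1)) := by
            gcongr; exact (min_le_left _ _).trans (min_le_right _ _)
        _ = 1 / 2 * (Cb / (Cb + 1)) := by ring
        _ ≤ 1 / 2 := mul_le_of_le_one_right (by positivity)
          ((div_le_one (by positivity)).2 (by linarith))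
  refine ⟨d, hd, fun f hf hfd => ?_⟩
  have hfb := abs_le_one_of_mem_Icc hf.2
  have hφm : Measurable fun θ => f θ - p θ := hf.1.sub hpd.1
  have hφb : ∀ θ, |f θ - p θ| ≤ 1 := hf.abs_sub_le hpd
  have hq : ∀ θ, |heat δ f θ - p θ| ≤ 2 * σ := fun θ => by
    have h1 := ha _ hφm hφb θ
    rw [heat_sub hf.1 hfb hpd.1 hpb] at h1
    have h2 : Ca * ∫ θ, |f θ - p θ| ≤ Ca * d := by gcongr
    have h3 := hheatp δ hδ le_rfl θ
    have h4 := abs_add_le (heat δ f θ - heat δ p θ) (heat δ p θ - p θ)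
    rw [sub_add_sub_cancel] at h4
    linarith
  have hqx : ∀ θ, |heatDx δ f θ| ≤ L + 1 := fun θ => by
    have h1 := hb _ hφm hφb θ
    rw [heatDx_sub hf.1 hfb hpd.1 hpb hδ] at h1
    have h2 : Cb * ∫ θ, |f θ - p θ| ≤ Cb * d := by gcongr
    have h3 := abs_heatDx_le_of_lipschitz hpd.1 hpb hL0 hlip hδ θ
    have h4 := abs_add_le (heatDx δ f θ - heatDx δ p θ) (heatDx δ p θ)
    rw [sub_add_cancel] at h4
    linarith
  -- A bound uniform in `s ≤ δ` is required, so the L¹ contraction is used here in place of the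
  -- smoothing estimate, which is taken at the single time `δ`.
  have hS : ∀ s, 0 < s → s ≤ δ → |entropy (heat s f) - entropy p| ≤ ε / 8 := fun s hs hsδ => by
    have h1 := hent _ _ (isDensity_heat hf s) hpd
    have h2 : ∫ θ, |heat s f θ - p θ| ≤ 2 * σ := by
      have hi1 : Integrable fun θ => |heat s (fun θ => f θ - p θ) θ| := by
        simp_rw [heat_sub hf.1 hfb hpd.1 hpb]
        exact ((isDensity_heat hf s).integrable.sub (isDensity_heat hpd s).integrable).abs
      have h3 : ∫ θ, |heat s f θ - p θ| ≤ ∫ θ, (|heat s (fun θ => f θ - p θ) θ| + σ) := by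
        refine integral_mono (((isDensity_heat hf s).integrable.sub hpd.integrable).abs)
          (hi1.add (integrable_const _)) fun θ => ?_
        simp only
        rw [heat_sub hf.1 hfb hpd.1 hpb]
        have h4 := abs_add_le (heat s f θ - heat s p θ) (heat s p θ - p θ)
        rw [sub_add_sub_cancel] at h4
        linarith [hheatp s hs hsδ θ]
      rw [integral_add hi1 (integrable_const _), integral_torus_const] at h3
      linarith [integral_abs_heat_le hφm hφb s]
    have h3 : CH * ∫ θ, |heat s f θ - p θ| ≤ CH * (2 * σ) := by gcongr
    linarith
  obtain ⟨hcad, hrate⟩ := rate_cheapPath_le hR hτ hδ hpd hp' hp'c hf (e := e) (L := L + 1)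
    (κ := m * e) (S := ε / 4) he le_rfl
    (fun θ => ⟨by linarith [(hpe θ).1], by linarith [(hpe θ).2]⟩)
    (fun θ => by
      have h1 := abs_le.1 (hq θ)
      constructor <;> linarith [(hpe θ).1, (hpe θ).2, h1.1, h1.2])
    (fun θ => (hL' θ).trans (by linarith)) hqx
    (fun θ => (hq θ).trans (by linarith))
    (fun s hs hsδ => by
      have h1 := abs_le.1 (hS s hs hsδ)
      have h2 := abs_le.1 (hS δ hδ le_rfl)
      linarith [h1.1, h2.2])
  refine ⟨τ + δ, by linarith, cheapPath p f τ δ, cheapPath_zero hτ, cheapPath_end hτ hδ, hcad,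
    hrate.trans (ENNReal.ofReal_le_ofReal ?_)⟩
  have h1 : τ * ((L + 1) ^ 2 / (8 * e ^ 2) + 2 * M) ≤ τ * K := by gcongr; linarith
  have h2 : τ * K = ε / 4 := by rw [hτdef]; field_simp
  linarith

/-! ### Stationary profiles and the quasi-potential -/

/-- A negative second derivative would make the minimum also a local maximum; `g` would be locally
constant, and its second derivative zero. -/
theorem deriv_deriv_nonneg_of_zero {g : ℝ → ℝ} (hg : Continuous g) (h0 : ∀ x, 0 ≤ g x) {x : ℝ}
    (hx : g x = 0) : 0 ≤ deriv (deriv g) x := by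
  by_contra! hneg
  have hmin : IsLocalMin g x := Eventually.of_forall fun y => by rw [hx]; exact h0 y
  have hmax := isLocalMax_of_deriv_deriv_neg hneg hmin.deriv_eq_zero hg.continuousAt
  have hev : g =ᶠ[𝓝 x] fun _ => 0 := by
    filter_upwards [hmax] with y hy
    exact le_antisymm (hy.trans_eq hx) (h0 y)
  have : deriv (deriv g) x = 0 := by
    rw [hev.deriv.deriv_eq]
    simp
  exact hneg.ne this

/-- A stationary profile takes its values in the open interval `(0,1)`. -/
theorem IsStationary.mem_Ioo {c : Config → ℝ} {m M : ℝ} (hR : RateBounds (birth c) (death c) m M)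
    {r : C2Profile} (h : IsStationary c r) (θ : UnitAddCircle) : r.fn θ ∈ Ioo (0 : ℝ) 1 := by
  obtain ⟨x, rfl⟩ := QuotientAddGroup.mk_surjective θ
  have hx := h x
  have hc : Continuous fun y : ℝ => r.fn y := r.contDiff.continuous
  rw [iteratedDeriv_succ, iteratedDeriv_one, reaction] at hx
  have hm := hR.m_pos
  refine ⟨(r.mem_Icc _).1.lt_of_ne fun h0 => ?_, (r.mem_Icc _).2.lt_of_ne fun h1 => ?_⟩
  -- At a zero of the profile, `F(0) ≥ m > 0` together with a nonnegative second derivative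
  -- contradicts the equation. At the value `1` the same argument applies to `1 - r.fn`, with `F(1)
  -- ≤ -m`.
  · have hd := deriv_deriv_nonneg_of_zero hc (fun y => (r.mem_Icc y).1) h0.symm
    rw [← h0] at hx
    linarith [hR.le_B 0 (by simp), hR.D_le 0 (by simp)]
  · have hd := deriv_deriv_nonneg_of_zero (g := fun y : ℝ => 1 - r.fn y) (continuous_const.sub hc)
      (fun y => sub_nonneg.2 (r.mem_Icc y).2) (x := x) (by simp [h1])
    have hdd : deriv (deriv fun y : ℝ => 1 - r.fn y) x = -deriv (deriv fun y : ℝ => r.fn y) x := by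
      have : deriv (fun y : ℝ => 1 - r.fn y) = fun y => -deriv (fun y : ℝ => r.fn y) y := by
        funext y; exact deriv_const_sub 1
      rw [this, deriv.fun_neg]
    rw [hdd] at hd
    rw [h1] at hx
    linarith [hR.B_le 1 (by simp), hR.le_D 1 (by simp)]

theorem Profile.toMeasure_injective : Function.Injective Profile.toMeasure := by
  intro p q h
  have h' : volume.withDensity (fun θ => ENNReal.ofReal (p.1 θ))
      = volume.withDensity (fun θ => ENNReal.ofReal (q.1 θ)) :=
    congrArg SubMeasure.meas h
  have hmeas : ∀ p : Profile, AEMeasurable fun θ => ENNReal.ofReal (p.1 θ) := fun p =>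
    (Lp.stronglyMeasurable p.1).measurable.ennreal_ofReal.aemeasurable
  have hfin : ∫⁻ θ, ENNReal.ofReal (p.1 θ) ≠ ⊤ := by
    have := withDensity_univ_le_one _ p.2
    rw [withDensity_apply _ MeasurableSet.univ, Measure.restrict_univ] at this
    exact (this.trans_lt ENNReal.one_lt_top).ne
  rw [withDensity_eq_iff (hmeas p) (hmeas q) hfin] at h'
  refine Subtype.ext (Lp.ext ?_)
  filter_upwards [h', p.2, q.2] with θ hθ hp hq
  exact (ENNReal.ofReal_eq_ofReal_iff hp.1 hq.1).1 hθ

theorem toMeasure_mem_orbitMeasures (r : C2Profile) : r.toProfile.toMeasure ∈ orbitMeasures r := by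
  refine ⟨0, ?_⟩
  have : r.translate 0 = r := by
    cases r
    simp [C2Profile.translate]
  rw [this]

/-- Truncation to `[0,1]` changes the representative on a null set only, and makes the bounds hold
everywhere. -/
theorem Profile.exists_isDensity (ρ : Profile) :
    ∃ f, IsDensity f ∧ (ρ.1 : UnitAddCircle → ℝ) =ᵐ[volume] f := by
  refine ⟨fun θ => projIcc (0 : ℝ) 1 zero_le_one (ρ.1 θ), ⟨?_, fun θ => Subtype.coe_prop _⟩, ?_⟩
  · exact (continuous_subtype_val.comp continuous_projIcc).measurable.comp
      (Lp.stronglyMeasurable ρ.1).measurable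
  · filter_upwards [ρ.2] with θ hθ
    rw [projIcc_of_mem _ hθ]

/-- The torus has total mass one, so the L¹ norm is at most the L² norm. -/
theorem integral_abs_sub_le_dist (p q : Profile) : ∫ θ, |p.1 θ - q.1 θ| ≤ dist p q := by
  have h1 : ∫ θ, |p.1 θ - q.1 θ| = ∫ θ, ‖(p.1 - q.1 : Lp ℝ 2 volume) θ‖ := by
    refine integral_congr_ae ?_
    filter_upwards [Lp.coeFn_sub p.1 q.1] with θ hθ
    rw [hθ]; rfl
  rw [h1, Subtype.dist_eq, dist_eq_norm, Lp.norm_def,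
    integral_norm_eq_lintegral_enorm (Lp.aestronglyMeasurable _), ← eLpNorm_one_eq_lintegral_enorm]
  have : IsProbabilityMeasure (volume : Measure UnitAddCircle) := ⟨UnitAddCircle.measure_univ⟩
  exact ENNReal.toReal_mono (Lp.eLpNorm_ne_top _)
    (eLpNorm_le_eLpNorm_of_exponent_le (by norm_num) (Lp.aestronglyMeasurable _))

theorem C2Profile.isDensity (r : C2Profile) : IsDensity r.fn :=
  ⟨r.continuous.measurable, r.mem_Icc⟩

theorem C2Profile.coeFn_toProfile (r : C2Profile) :
    (r.toProfile.1 : UnitAddCircle → ℝ) =ᵐ[volume] r.fn := r.memLp.coeFn_toLp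

/-- The cheap path starts from `r`, an admissible starting point because its measure lies in the
orbit of `ρbar`. The two are kept apart since the classical solution supplied by the classification
is only known to define the same measure. -/
theorem tendsto_profilePotential {c : Config → ℝ} {m M : ℝ}
    (hR : RateBounds (birth c) (death c) m M) {r ρbar : C2Profile}
    (hr : ∀ θ, r.fn θ ∈ Ioo (0 : ℝ) 1) (horb : r.toProfile.toMeasure ∈ orbitMeasures ρbar) :
    Tendsto (profilePotential c ρbar) (𝓝 r.toProfile) (𝓝 0) := by
  rw [ENNReal.tendsto_nhds_zero]
  intro ε hε
  obtain ⟨ε', hε', hle⟩ : ∃ ε' : ℝ, 0 < ε' ∧ ENNReal.ofReal ε' ≤ ε := by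
    rcases eq_or_ne ε ⊤ with rfl | htop
    · exact ⟨1, one_pos, le_top⟩
    · exact ⟨ε.toReal, ENNReal.toReal_pos hε.ne' htop, ENNReal.ofReal_toReal_le⟩
  obtain ⟨d, hd, h⟩ := exists_cheap_path hR hr hε'
  filter_upwards [Metric.ball_mem_nhds r.toProfile hd] with ρ hρ
  refine le_trans ?_ hle
  obtain ⟨f, hf, hρf⟩ := ρ.exists_isDensity
  have hdist : ∫ θ, |f θ - r.fn θ| < d := by
    have : ∫ θ, |f θ - r.fn θ| = ∫ θ, |ρ.1 θ - r.toProfile.1 θ| := by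
      refine integral_congr_ae ?_
      filter_upwards [hρf, r.coeFn_toProfile] with θ h1 h2
      rw [h1, h2]
    rw [this]
    exact (integral_abs_sub_le_dist ρ r.toProfile).trans_lt hρ
  obtain ⟨T, hT, w, hw0, hwT, hcad, hrate⟩ := h f hf hdist
  have h0 : measureOf (w 0) = r.toProfile.toMeasure := by
    rw [hw0]; exact measureOf_eq_of_ae r.isDensity r.coeFn_toProfile
  have hend : measureOf (w T) = ρ.toMeasure := by
    rw [hwT]; exact measureOf_eq_of_ae hf hρf
  refine iInf_le_of_le T (iInf_le_of_le hT (iInf_le_of_le r.toProfile (iInf_le_of_le horb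
    (iInf_le_of_le (fun t => measureOf (w t)) (iInf_le_of_le hcad (iInf_le_of_le hend ?_))))))
  rw [rateFrom, if_pos h0]
  exact hrate

end

end ReactionDiffusion

/-! ### The theorem -/

open ReactionDiffusion
theorem theorem4p2 (c : Config → ℝ) (hpos : ∀ η, 0 < c η)
    (hcyl : ∃ Λ : Finset ℤ, DependsOn c (Λ : Set ℤ))
    (l : ℕ) (ρbar : Fin l → C2Profile)
    (hsol : solMeasures c = ⋃ i, orbitMeasures (ρbar i)) (i : Fin l) :
    ContinuousAt (profilePotential c (ρbar i)) (ρbar i).toProfile ∧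
      ∀ ρ : ℕ → Profile, Tendsto ρ atTop (𝓝 (ρbar i).toProfile) →
        Tendsto (fun n => profilePotential c (ρbar i) (ρ n)) atTop (𝓝 0) := by
  obtain ⟨m, M, hR⟩ := exists_rateBounds c hpos hcyl
  have horb := toMeasure_mem_orbitMeasures (ρbar i)
  -- The classification places the measure of `ρbar i` among those of classical solutions, which
  -- gives access to the bounds `0 < r < 1`.
  obtain ⟨r, hr, hmeas⟩ : (ρbar i).toProfile.toMeasure ∈ solMeasures c := by
    rw [hsol]; exact mem_iUnion.2 ⟨i, horb⟩
  have heq : (ρbar i).toProfile = r.toProfile := Profile.toMeasure_injective hmeas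
  have hlim : Tendsto (profilePotential c (ρbar i)) (𝓝 (ρbar i).toProfile) (𝓝 0) := by
    rw [heq] at horb ⊢
    exact tendsto_profilePotential hR (hr.mem_Ioo hR) horb
  refine ⟨?_, fun ρ hρ => hlim.comp hρ⟩
  -- The neighbourhood filter contains the point itself, so the limit `0` is also the value there.
  have hzero : profilePotential c (ρbar i) (ρbar i).toProfile = 0 :=
    tendsto_nhds_unique (tendsto_pure_nhds _ _) (hlim.mono_left (pure_le_nhds _))
  rw [ContinuousAt, hzero]
  exact hlim
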